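/- **Setting.** Let $d\ge 1$, let $D\subset\mathbb R^d$ be a nonempty bounded convex domain, $S$ the unit sphere of $\mathbb R^d$ with surface measure, $U=L_2(D\times S)$. Let $\Gamma_+$ be the set of $(x,s)\in\partial D\times S$ for which the outer unit normal $n(x)$ is well defined and $s\cdot n(x)>0$, and let $V=H_{0,+}(D\times S)$ be the closure of $\{v\in C^1(\overline{D\times S}): v|_{\Gamma_+}=0\}$ in the norm $\|v\|_V=(\|v\|_U^2+\|s\cdot\nabla v\|_U^2)^{1/2}$. We regard $U\subset V'$ through $\langle w,v\rangle=\int_{D\times S}wv$. Let $0\le\sigma\in L_\infty(D\times S)$ and $0\le K\in L_\infty(D;L_2(S\times S))$ be measurable. Put $\bar\sigma(x,s)=\int_S K(x,s,s')\,ds'$ and $\bar\sigma'(x,s)=\int_S K(x,s',s)\,ds'$, and assume that for constants $\alpha>0$, $M_a$, $M_a'$, almost everywhere, $$\sigma-\bar\sigma\ge\alpha,\quad \sigma-\bar\sigma'\ge\alpha,\quad \bar\sigma\le M_a,\quad \bar\sigma'\le M_a'.$$ Define $\mathcal T,\mathcal K:U\to V'$ by $$\langle\mathcal Tw,v\rangle=\int_{D\times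 S} w(\sigma v-s\cdot\nabla v)\,dx\,ds,\qquad (\mathcal Kw)(x,s)=\int_S K(x,s',s)w(x,s')\,ds'.$$ Write $\sigma_{\min},\sigma_{\max}$ for the essential infimum and supremum of $\sigma$, $\gamma=\operatorname{ess\,sup}\max\{\bar\sigma/\sigma,\bar\sigma'/\sigma\}$, $\hat\ell=\operatorname{diam}D$ and $$R(\sigma,\alpha)=\min\Big\{\frac{\gamma\sigma_{\max}}{\sigma_{\min}},\ \frac{\sigma_{\max}-\alpha}{\sigma_{\min}},\ \sqrt{M_aM_a'}\,\min\big\{\hat\ell,\sqrt{\hat\ell/(2\sigma_{\min})}\big\}\Big\}.$$ Let $\zeta(\beta)=\sum_{j\ge1}j^{-\beta}$. An *initial bound* for the equation $(\mathcal T-\mathcal K)u=f$ is a number $b_0$ with $\|u\|_U\le b_0$ for the solution $u$, or, if $f\in U$, the number $b_0=\alpha^{-1}\|f\|_U$. **Algorithm ASTI$[\mathcal T,\mathcal K,f;\varepsilon]$.** Fix $\beta>1$, $\rho$ with $R(\sigma,\alpha)\le\rho$ and $0<\rho<1$, $C_{\mathcal T}\ge\|\mathcal T^{-1}\|_{\mathcal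 L(V',U)}$, $\kappa_1,\kappa_2,\kappa_3\ge0$ with $C_{\mathcal T}(\kappa_1+\kappa_2)+\kappa_3\le1$, and an initial bound $b_0$. The error-controlled routines return, for each tolerance $\eta>0$ (and, exactly evaluated, for $\eta=0$ if the corresponding $\kappa_i$ is $0$), $[\mathcal K,w;\eta]\in V'$, $[f;\eta]\in V'$, $[\mathcal T^{-1},g;\eta]\in U$ with $$\|\mathcal Kw-[\mathcal K,w;\eta]\|_{V'}\le\eta,\quad \|f-[f;\eta]\|_{V'}\le\eta,\quad \|\mathcal T^{-1}g-[\mathcal T^{-1},g;\eta]\|_U\le\eta .$$ Start with $n=0$, $\bar u_0=0$, $\mathrm{err}=b=b_0$. While $\mathrm{err}>\varepsilon$, put $\eta_n=(1+n)^{-\beta}\rho^n$ and set successively $$\bar u_{n+1}=\big[\mathcal T^{-1},[\mathcal K,\bar u_n;\kappa_1\eta_n]+[f;\kappa_2\eta_n];\kappa_3\eta_n\big],\quad \mathrm{err}=(\rho b+\zeta(\beta))\rho^n,$$ $$b\leftarrow\min\{b,\ \|\bar u_{n+1}\|_U+(\rho b+\zeta(\beta))\rho^{n-1}\},\quad n\leftarrow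 n+1 .$$ Return $\bar u_n$. **Algorithm N-ASTI$[\mathcal T-\mathcal K,f;\varepsilon]$.** Take an estimate $\rho\ge R(\sigma,\alpha)$. If $\rho<1$ (dominating transport), return ASTI$[\mathcal T,\mathcal K,f;\varepsilon]$. If $\rho\ge1$ (dominating scattering), take $\beta>1$, $a^*>0$ and $\rho^*<1$ such that $$\frac{a^*}{a^*+\alpha}\le\rho^*,\qquad \frac{(\sigma_{\max}-\alpha)(\sigma_{\max}+a^*)}{(\sigma_{\min}+a^*)^2}\le\rho^*$$ (for instance, $a^*$ makes the two left-hand sides equal and $\rho^*$ is their common value), an initial bound $b_0$, and a routine returning for each $\eta>0$ an approximation $[(a^*)^{-1}f;\eta]\in V'$ whose error lies in $U$ with $\|(a^*)^{-1}f-[(a^*)^{-1}f;\eta]\|_U\le\eta$. Start with $n=0$, $\bar u_0=0$, $\mathrm{err}=b=b_0$. While $\mathrm{err}>\varepsilon$, put $\eta_n=(1+n)^{-\beta}(\rho^*)^n$ and set successively $$\bar u_{n+1}=a^*\,\mathrm{ASTI}\big[\mathcal T+a^*\mathrm{id},\mathcal K,\ \bar u_n+[(a^*)^{-1}f;\eta_n];\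 \eta_n\big],\quad \mathrm{err}=\big(\rho^*b+(1+a^*)\zeta(\beta)\big)(\rho^*)^n,$$ $$b\leftarrow\min\{b,\ \|\bar u_{n+1}\|_U+(\rho^*b+(1+a^*)\zeta(\beta))(\rho^*)^{n-1}\},\quad n\leftarrow n+1 .$$ Return $\bar u_n$. Here the inner ASTI has its own parameters and routines, with $\sigma,\alpha$ replaced by $\sigma+a^*,\alpha+a^*$. **Theorem.** For every $f\in V'$ there is exactly one $u\in U$ with $$\langle(\mathcal T-\mathcal K)u,v\rangle=\langle f,v\rangle\quad\text{for all }v\in V,$$ and for every $\varepsilon>0$ Algorithm N-ASTI (in either regime, for all admissible parameters and routines as above) terminates and its output $u_\varepsilon$ satisfies $\|u-u_\varepsilon\|_{L_2(D\times S)}\le\varepsilon$. -/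

import Mathlib

open MeasureTheory

noncomputable section

namespace RadTrans

/-! ### Phase space and function spaces -/

/-- The space `ℝᵈ`. -/
abbrev Space (d : ℕ) := EuclideanSpace ℝ (Fin d)

/-- The unit sphere of directions. -/
abbrev Dir (d : ℕ) := Metric.sphere (0 : Space d) 1

/-- Surface measure on the sphere of directions. -/
def dirMeasure (d : ℕ) : Measure (Dir d) := (volume : Measure (Space d)).toSphere

/-- The measure `dx ds` on `D × S`. -/
def phaseMeasure {d : ℕ} (D : Set (Space d)) : Measure (Space d × Dir d) :=
  (volume.restrict D).prod (dirMeasure d)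

/-- The trial space `U = L₂(D × S)`. -/
abbrev TrialSpace {d : ℕ} (D : Set (Space d)) := Lp ℝ 2 (phaseMeasure D)

/-- `n` is an outer unit normal of the convex set `D` at `x`. -/
def IsOuterNormal {d : ℕ} (D : Set (Space d)) (x n : Space d) : Prop :=
  ‖n‖ = 1 ∧ ∀ y ∈ D, inner ℝ n (y - x) ≤ 0

/-- The outflow boundary `Γ₊`: all `(x, s)` with `|s| = 1`, where `x` is a boundary point of `D` at
which the outer unit normal `n(x)` is well defined (that is, unique), and `s · n(x) > 0`. -/
def outflow {d : ℕ} (D : Set (Space d)) : Set (Space d × Space d) :=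
  {p | p.1 ∈ frontier D ∧ ‖p.2‖ = 1 ∧
    ∃ n, IsOuterNormal D p.1 n ∧ (∀ m, IsOuterNormal D p.1 m → m = n) ∧ 0 < inner ℝ p.2 n}

/-- The directional derivative `s · ∇v` in the spatial variable. -/
def streamDeriv {d : ℕ} (v : Space d × Space d → ℝ) (z : Space d × Dir d) : ℝ :=
  fderiv ℝ v (z.1, (z.2 : Space d)) ((z.2 : Space d), 0)

/-- All pairs `(v, s · ∇v)` in `L₂ × L₂`, for `v` a `C¹` function up to the boundary (the
restriction of a `C¹` function on the ambient space) that vanishes on `Γ₊`. The norm of the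
ambient space is `(‖v‖² + ‖s · ∇v‖²)^{1/2}`, the norm of `H(D × S)`. -/
def smoothTestPairs {d : ℕ} (D : Set (Space d)) :
    Submodule ℝ (WithLp 2 (TrialSpace D × TrialSpace D)) where
  carrier := {p | ∃ v : Space d × Space d → ℝ, ContDiff ℝ 1 v ∧ (∀ z ∈ outflow D, v z = 0) ∧
    (p.fst =ᵐ[phaseMeasure D] fun z => v (z.1, (z.2 : Space d))) ∧
    (p.snd =ᵐ[phaseMeasure D] streamDeriv v)}
  zero_mem' := by
    refine ⟨fun _ => 0, contDiff_const, fun _ _ => rfl, Lp.coeFn_zero _ _ _, ?_⟩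
    filter_upwards [Lp.coeFn_zero ℝ 2 (phaseMeasure D)] with z hz
    simpa [streamDeriv] using hz
  add_mem' := by
    rintro p q ⟨v, hv, hv0, hp1, hp2⟩ ⟨w, hw, hw0, hq1, hq2⟩
    refine ⟨fun z => v z + w z, hv.add hw, fun z hz => by simp [hv0 z hz, hw0 z hz], ?_, ?_⟩
    · filter_upwards [Lp.coeFn_add p.fst q.fst, hp1, hq1] with z h h1 h2
      simp only [WithLp.add_fst]
      rw [h, Pi.add_apply, h1, h2]
    · filter_upwards [Lp.coeFn_add p.snd q.snd, hp2, hq2] with z h h1 h2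
      simp only [WithLp.add_snd]
      rw [h, Pi.add_apply, h1, h2]
      simp only [streamDeriv]
      rw [fderiv_fun_add (hv.differentiable one_ne_zero _) (hw.differentiable one_ne_zero _)]
      rfl
  smul_mem' := by
    rintro c p ⟨v, hv, hv0, hp1, hp2⟩
    refine ⟨fun z => c * v z, contDiff_const.mul hv, fun z hz => by simp [hv0 z hz], ?_, ?_⟩
    · filter_upwards [Lp.coeFn_smul c p.fst, hp1] with z h h1
      simp only [WithLp.smul_fst]
      rw [h, Pi.smul_apply, h1, smul_eq_mul]
    · filter_upwards [Lp.coeFn_smul c p.snd, hp2] with z h h1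
      simp only [WithLp.smul_snd]
      rw [h, Pi.smul_apply, h1]
      simp only [streamDeriv]
      rw [fderiv_const_mul (hv.differentiable one_ne_zero _)]
      rfl

/-- The test space `V = H_{0,+}(D × S)`, the closure in the graph norm of the `C¹` functions that
vanish on `Γ₊`. An element is stored as the pair of `v` and its weak derivative `s · ∇v` (the
second entry is determined by the first). -/
abbrev TestSpace {d : ℕ} (D : Set (Space d)) : Type := (smoothTestPairs D).topologicalClosure

namespace TestSpace

variable {d : ℕ} {D : Set (Space d)}

/-- The function `v ∈ L₂(D × S)`. -/
def fn (v : TestSpace D) : TrialSpace D :=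
  WithLp.fst (v : WithLp 2 (TrialSpace D × TrialSpace D))

/-- The weak derivative `s · ∇v ∈ L₂(D × S)`. -/
def sd (v : TestSpace D) : TrialSpace D :=
  WithLp.snd (v : WithLp 2 (TrialSpace D × TrialSpace D))

end TestSpace

/-- The dual space `V'`, with the dual norm. -/
abbrev DualSpace {d : ℕ} (D : Set (Space d)) : Type := StrongDual ℝ (TestSpace D)

/-- The embedding of `L₂(D × S)` into `V'`: `w` acts by `v ↦ ∫ w v`. -/
def embed {d : ℕ} {D : Set (Space d)} (w : TrialSpace D) : DualSpace D :=
  (innerSL ℝ w).comp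
    ((WithLp.fstL 2 ℝ (TrialSpace D) (TrialSpace D)).comp
      (smoothTestPairs D).topologicalClosure.subtypeL)

/-! ### Optical parameters and operators -/

/-- The optical parameters `σ(x, s)` and `K(x, s, s')`, with the constants `α`, `M_a`, `M_a'`. -/
structure Optics (d : ℕ) where
  σ : Space d × Dir d → ℝ
  K : Space d → Dir d → Dir d → ℝ
  α : ℝ
  M : ℝ
  M' : ℝ

namespace Optics

variable {d : ℕ}

/-- The optical parameters of `𝒯 + a · id - 𝒦`: both `σ` and `α` are shifted by `a`. -/
def shift (c : Optics d) (a : ℝ) : Optics d :=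
  { c with σ := fun z => c.σ z + a, α := c.α + a }

/-- `σ̄(x, s) = ∫ K(x, s, s') ds'`. -/
def outScat (c : Optics d) (z : Space d × Dir d) : ℝ := ∫ s', c.K z.1 z.2 s' ∂(dirMeasure d)

/-- `σ̄'(x, s) = ∫ K(x, s', s) ds'`. -/
def inScat (c : Optics d) (z : Space d × Dir d) : ℝ := ∫ s', c.K z.1 s' z.2 ∂(dirMeasure d)

/-- The assumptions on the optical parameters: `0 ≤ σ ∈ L_∞(D × S)`,
`0 ≤ K ∈ L_∞(D; L₂(S × S))`, and `σ - σ̄ ≥ α`, `σ - σ̄' ≥ α`, `σ̄ ≤ M_a`, `σ̄' ≤ M_a'` almost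
everywhere, with `α > 0`. -/
structure Admissible (c : Optics d) (D : Set (Space d)) : Prop where
  measurable_σ : Measurable c.σ
  nonneg_σ : ∀ᵐ z ∂(phaseMeasure D), 0 ≤ c.σ z
  bounded_σ : ∃ C : ℝ, ∀ᵐ z ∂(phaseMeasure D), c.σ z ≤ C
  measurable_K : Measurable fun p : Space d × Dir d × Dir d => c.K p.1 p.2.1 p.2.2
  nonneg_K : ∀ x ∈ D, ∀ s s', 0 ≤ c.K x s s'
  bounded_K : ∃ C : ℝ, ∀ᵐ x ∂(volume.restrict D),
    ∫⁻ p, ENNReal.ofReal (c.K x p.1 p.2 ^ 2) ∂((dirMeasure d).prod (dirMeasure d))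
      ≤ ENNReal.ofReal C
  pos_α : 0 < c.α
  gap_out : ∀ᵐ z ∂(phaseMeasure D), c.α ≤ c.σ z - c.outScat z
  gap_in : ∀ᵐ z ∂(phaseMeasure D), c.α ≤ c.σ z - c.inScat z
  out_le : ∀ᵐ z ∂(phaseMeasure D), c.outScat z ≤ c.M
  in_le : ∀ᵐ z ∂(phaseMeasure D), c.inScat z ≤ c.M'

/-- `σ_min`. -/
def σmin (c : Optics d) (D : Set (Space d)) : ℝ := essInf c.σ (phaseMeasure D)

/-- `σ_max`. -/
def σmax (c : Optics d) (D : Set (Space d)) : ℝ := essSup c.σ (phaseMeasure D)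

/-- `γ = sup {σ̄ / σ, σ̄' / σ}`. -/
def γ (c : Optics d) (D : Set (Space d)) : ℝ :=
  essSup (fun z => max (c.outScat z / c.σ z) (c.inScat z / c.σ z)) (phaseMeasure D)

/-- The computable upper bound for the norm of `𝒯⁻¹ 𝒦` on `L₂(D × S)`, in terms of
`ζ = γ σ_max / σ_min`, `(σ_max - α) / σ_min` and the diameter of `D`. -/
def contractionBound (c : Optics d) (D : Set (Space d)) : ℝ :=
  min (c.γ D * c.σmax D / c.σmin D)
    (min ((c.σmax D - c.α) / c.σmin D)
      (√(c.M * c.M') * min (Metric.diam D) (√(Metric.diam D / (2 * c.σmin D)))))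

variable {D : Set (Space d)}

/-- The bilinear form `a(w, v) = ∫ w (σ v - s · ∇v) dx ds` of the transport operator `𝒯`. -/
def transportForm (c : Optics d) (w : TrialSpace D) (v : TestSpace D) : ℝ :=
  ∫ z, w z * (c.σ z * v.fn z - v.sd z) ∂(phaseMeasure D)

/-- The function `(𝒦 w)(x, s) = ∫ K(x, s', s) w(x, s') ds'`. -/
def scatter (c : Optics d) (w : TrialSpace D) (z : Space d × Dir d) : ℝ :=
  ∫ s', c.K z.1 s' z.2 * w (z.1, s') ∂(dirMeasure d)

/-- The bilinear form `k(w, v) = ⟨𝒦 w, v⟩`. -/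
def scatterForm (c : Optics d) (w : TrialSpace D) (v : TestSpace D) : ℝ :=
  ∫ z, c.scatter w z * v.fn z ∂(phaseMeasure D)

/-- `𝒯 w = g` in `V'`. -/
def IsTransportSolution (c : Optics d) (g : DualSpace D) (w : TrialSpace D) : Prop :=
  ∀ v : TestSpace D, c.transportForm w v = g v

/-- `(𝒯 - 𝒦) u = f` in `V'`, the radiative transfer equation in the variational formulation with
trial space `L₂(D × S)` and test space `H_{0,+}(D × S)`. -/
def IsSolution (c : Optics d) (f : DualSpace D) (u : TrialSpace D) : Prop :=
  ∀ v : TestSpace D, c.transportForm u v - c.scatterForm u v = f v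

/-- `b` may serve as the initial bound `b₀(u)` for `‖u‖`, where `(𝒯 - 𝒦) u = f`: it is an upper
bound, or it is the default choice `α⁻¹ ‖f‖` for `f ∈ L₂(D × S)`. -/
def IsInitialBound (c : Optics d) (f : DualSpace D) (b : ℝ) : Prop :=
  (∀ u : TrialSpace D, c.IsSolution f u → ‖u‖ ≤ b) ∨
    ∃ F : TrialSpace D, embed F = f ∧ b = c.α⁻¹ * ‖F‖

end Optics

/-! ### The algorithms -/

/-- `ζ(β) = ∑_{j ≥ 1} j^{-β}`. -/
def zetaSum (β : ℝ) : ℝ := ∑' j : ℕ, ((j : ℝ) + 1) ^ (-β)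

/-- The tolerances `η_n = (1 + n)^{-β} ρⁿ`. -/
def tol (β ρ : ℝ) (n : ℕ) : ℝ := (1 + (n : ℝ)) ^ (-β) * ρ ^ n

variable {d : ℕ} {D : Set (Space d)}

/-- The variables of the iterations: the counter `n`, the iterate `ū_n`, the current error bound
`err`, and the current bound `b` for the norm of the solution. -/
structure LoopState (D : Set (Space d)) where
  n : ℕ
  u : TrialSpace D
  err : ℝ
  b : ℝ

/-- `while err > ε do step`, followed by `return ū_n`. This is a partial value, defined precisely
if the loop, and every call in it, terminates. -/
def runLoop (ε : ℝ) (step : LoopState D → Part (LoopState D)) (init : LoopState D) :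
    Part (TrialSpace D) :=
  PFun.fix
    (fun s => if ε < s.err then (step s).map Sum.inr else Part.some (Sum.inl s.u)) init

/-- What a call of ASTI uses: the numbers fixed in its first line (`C` is the bound for `‖𝒯⁻¹‖`,
and `b₀ f` the initial bound for the norm of the solution with source `f`), and the routines
`[𝒦, w; η]`, `[f; η]` and `[𝒯⁻¹, g; η]`. -/
structure AstiData (D : Set (Space d)) where
  β : ℝ
  κ₁ : ℝ
  κ₂ : ℝ
  κ₃ : ℝ
  ρ : ℝ
  C : ℝ
  b₀ : DualSpace D → ℝ
  applyK : TrialSpace D → ℝ → DualSpace D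
  approx : DualSpace D → ℝ → DualSpace D
  solveT : DualSpace D → ℝ → TrialSpace D

/-- Admissible parameters and error-controlled routines for ASTI with `𝒯` and `𝒦` given by `c`.
Routines are called with positive tolerances, and with tolerance `0` only if the corresponding
weight `κᵢ` is chosen to be `0` (exact evaluation). -/
structure AstiData.Admissible (A : AstiData D) (c : Optics d) : Prop where
  one_lt_β : 1 < A.β
  nonneg_κ₁ : 0 ≤ A.κ₁
  nonneg_κ₂ : 0 ≤ A.κ₂
  nonneg_κ₃ : 0 ≤ A.κ₃
  -- `‖𝒯⁻¹‖_{V' → U} ≤ C`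
  norm_inv_le : ∀ (g : DualSpace D) (w : TrialSpace D),
    c.IsTransportSolution g w → ‖w‖ ≤ A.C * ‖g‖
  weights : A.C * (A.κ₁ + A.κ₂) + A.κ₃ ≤ 1
  -- `ρ` is an estimate of the contraction number from above
  pos_ρ : 0 < A.ρ
  bound_le_ρ : c.contractionBound D ≤ A.ρ
  ρ_lt_one : A.ρ < 1
  initial : ∀ f : DualSpace D, c.IsInitialBound f (A.b₀ f)
  -- `‖𝒦 w - [𝒦, w; η]‖_{V'} ≤ η`
  applyK_spec : ∀ (w : TrialSpace D) (η : ℝ), (0 < η ∨ (η = 0 ∧ A.κ₁ = 0)) →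
    ∀ v : TestSpace D, |c.scatterForm w v - A.applyK w η v| ≤ η * ‖v‖
  -- `‖f - [f; η]‖_{V'} ≤ η`
  approx_spec : ∀ (f : DualSpace D) (η : ℝ), (0 < η ∨ (η = 0 ∧ A.κ₂ = 0)) →
    ‖f - A.approx f η‖ ≤ η
  -- `‖[𝒯⁻¹, g; η] - 𝒯⁻¹ g‖_U ≤ η`
  solveT_spec : ∀ (g : DualSpace D) (η : ℝ), (0 < η ∨ (η = 0 ∧ A.κ₃ = 0)) →
    ∀ w : TrialSpace D, c.IsTransportSolution g w → ‖A.solveT g η - w‖ ≤ η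

/-- One pass through the loop of ASTI. -/
def astiStep (A : AstiData D) (f : DualSpace D) (s : LoopState D) : LoopState D :=
  let η := tol A.β A.ρ s.n
  let w := A.applyK s.u (A.κ₁ * η)
  let g := A.approx f (A.κ₂ * η)
  let u' := A.solveT (w + g) (A.κ₃ * η)
  { n := s.n + 1
    u := u'
    err := (A.ρ * s.b + zetaSum A.β) * A.ρ ^ s.n
    b := min s.b (‖u'‖ + (A.ρ * s.b + zetaSum A.β) * A.ρ ^ ((s.n : ℤ) - 1)) }

/-- The algorithm ASTI with source `f` and target accuracy `ε`. -/
def asti (A : AstiData D) (f : DualSpace D) (ε : ℝ) : Part (TrialSpace D) :=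
  runLoop ε (fun s => Part.some (astiStep A f s)) ⟨0, 0, A.b₀ f, A.b₀ f⟩

/-- What the scattering-dominated branch of N-ASTI uses: the shift `a = a*`, the contraction number
`ρ = ρ*`, the exponent `β`, the initial bound `b₀` for the norm of the solution, the routine
`[(a*)⁻¹ f; η]`, and the data of the inner ASTI calls for `𝒯 + a* · id`. -/
structure NestedData (D : Set (Space d)) where
  a : ℝ
  ρ : ℝ
  β : ℝ
  b₀ : ℝ
  approxSource : ℝ → DualSpace D
  inner : AstiData D

/-- Admissible data for the scattering-dominated branch. The bounds on `a` and `ρ` hold with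
equality if `a` solves the balance equation
`a / (a + α) = (σ_max - α) (σ_max + a) / (σ_min + a)²` and `ρ` is the common value of its sides.
The approximations of `(a*)⁻¹ f` have errors in `L₂(D × S)` of norm at most `η`. -/
structure NestedData.Admissible (N : NestedData D) (c : Optics d) (f : DualSpace D) : Prop where
  pos_a : 0 < N.a
  left_le_ρ : N.a / (N.a + c.α) ≤ N.ρ
  right_le_ρ : (c.σmax D - c.α) * (c.σmax D + N.a) / ((c.σmin D + N.a) * (c.σmin D + N.a)) ≤ N.ρ
  ρ_lt_one : N.ρ < 1
  one_lt_β : 1 < N.β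
  initial : c.IsInitialBound f N.b₀
  approxSource_spec : ∀ η : ℝ, 0 < η →
    ∃ e : TrialSpace D, N.a⁻¹ • f - N.approxSource η = embed e ∧ ‖e‖ ≤ η
  inner_admissible : N.inner.Admissible (c.shift N.a)

/-- One pass through the outer loop of the scattering-dominated branch. -/
def nestedStep (N : NestedData D) (s : LoopState D) : Part (LoopState D) :=
  let η := tol N.β N.ρ s.n
  let g := embed s.u + N.approxSource η
  (asti N.inner g η).map fun y =>
    let u' := N.a • y
    { n := s.n + 1
      u := u'
      err := (N.ρ * s.b + (1 + N.a) * zetaSum N.β) * N.ρ ^ s.n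
      b := min s.b
        (‖u'‖ + (N.ρ * s.b + (1 + N.a) * zetaSum N.β) * N.ρ ^ ((s.n : ℤ) - 1)) }

/-- What N-ASTI uses: the estimate `ρ` of the contraction number, and the data of both branches. -/
structure NAstiData (D : Set (Space d)) where
  ρ : ℝ
  transport : AstiData D
  nested : NestedData D

/-- Admissible data for N-ASTI: only the branch that is entered matters. -/
structure NAstiData.Admissible (P : NAstiData D) (c : Optics d) (f : DualSpace D) : Prop where
  bound_le_ρ : c.contractionBound D ≤ P.ρ
  transport_admissible : P.ρ < 1 → P.transport.Admissible c
  nested_admissible : 1 ≤ P.ρ → P.nested.Admissible c f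

/-- The algorithm N-ASTI with source `f` and target accuracy `ε`. -/
def nAsti (P : NAstiData D) (f : DualSpace D) (ε : ℝ) : Part (TrialSpace D) :=
  if P.ρ < 1 then asti P.transport f ε
  else runLoop ε (nestedStep P.nested) ⟨0, 0, P.nested.b₀, P.nested.b₀⟩

end RadTrans

end

/-! All derivatives sit on the test function. With `B v = (σ - 𝒦*) v - s · ∇v`, a bounded map from
`V` to `U`, the equation reads `⟨u, B v⟩ = f v` for all `v`. Once `B` is bijective, `u` is the Riesz
representative of `f ∘ B⁻¹`, and the estimate `‖v‖ ≤ α⁻¹ ‖B v‖` in `L₂` passes to the solution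
operator by duality.

Bijectivity has three ingredients. The multiplier part is coercive with constant `α`, by Young's
inequality for the kernel (`coercive`). The operator `-s · ∇` is accretive on `V`
(`inner_sd_fn_nonpos`). For constant `l > 0`, `l - s · ∇` has dense range, because smooth sources
can be integrated along rays (`eq_zero_of_orthogonal`). A perturbation argument passes from `l` to
every bounded coercive coefficient (`bijective_of_accretive`).

Accretivity is delicate because `∂D` is only the boundary of a convex set. `integral_fderiv_nonpos`
replaces the divergence theorem by translations of `D`. It needs almost every ray to leave `D`
through `Γ₊`, which holds because the exit time is concave, hence differentiable almost everywhere,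
and differentiability forces a unique normal (`exit_mem_outflow`). The same inequality with weights
depending on the position along the direction gives the transport bounds in terms of the diameter.
Together with the Schur test they yield `‖𝒯⁻¹ 𝒦‖ ≤ R(σ, α)` (`norm_le_contractionBound`).

Both algorithms are perturbed fixed-point iterations: `u = 𝒯⁻¹ (𝒦 u + f)` with contraction number
`ρ`, and `u = a R (u + a⁻¹ f)` with `R = (𝒯 + a - 𝒦)⁻¹`, whose norm on `L₂` is at most `1 / (α +
a)`. The tolerances contain the factor `ρⁿ`, so the accumulated errors are `ρⁿ` times a partial sum
of `ζ(β)`. `runLoop_iteration` treats both loops at once. -/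

noncomputable section

namespace RadTrans

/-! ### Accretive operators between Hilbert spaces -/

section Abstract

variable {U V : Type*} [NormedAddCommGroup U] [InnerProductSpace ℝ U] [CompleteSpace U]
  [NormedAddCommGroup V] [NormedSpace ℝ V] [CompleteSpace V]

/-- An operator that is bounded below and has dense range is onto. -/
theorem surjective_of_bound_of_orthogonal (B : V →L[ℝ] U) (C : ℝ) (hC : ∀ v, ‖v‖ ≤ C * ‖B v‖)
    (horth : ∀ w : U, (∀ v, inner ℝ w (B v) = 0) → w = 0) : Function.Surjective B := by
  have hanti : AntilipschitzWith (Real.toNNReal C) B := by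
    refine B.antilipschitz_of_bound fun v => (hC v).trans ?_
    exact mul_le_mul_of_nonneg_right (Real.le_coe_toNNReal C) (norm_nonneg _)
  have hclosed : IsClosed (B.range : Set U) := by
    have := hanti.isClosed_range B.uniformContinuous
    exact this
  have hbot : B.rangeᗮ = ⊥ := by
    rw [Submodule.eq_bot_iff]
    intro w hw
    refine horth w fun v => ?_
    rw [Submodule.mem_orthogonal] at hw
    rw [real_inner_comm]
    exact hw (B v) ⟨v, rfl⟩
  have : CompleteSpace B.range := hclosed.completeSpace_coe
  have htop : B.range = ⊤ := (Submodule.orthogonal_eq_bot_iff).1 hbot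
  intro u
  have : u ∈ B.range := by rw [htop]; trivial
  simpa using this

omit [CompleteSpace U] [CompleteSpace V] in
/-- Coercivity bounds the first component of the graph norm. -/
theorem norm_le_of_accretive {j s : V →L[ℝ] U} (hacc : ∀ v, inner ℝ (s v) (j v) ≤ 0)
    {M : U →L[ℝ] U} {α : ℝ} (hα : 0 < α) (hM : ∀ u, α * ‖u‖ ^ 2 ≤ inner ℝ (M u) u) (v : V) :
    ‖j v‖ ≤ α⁻¹ * ‖M (j v) - s v‖ := by
  have h1 : α * ‖j v‖ ^ 2 ≤ inner ℝ (M (j v) - s v) (j v) := by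
    rw [inner_sub_left]; linarith [hacc v, hM (j v)]
  have h2 := real_inner_le_norm (M (j v) - s v) (j v)
  rw [inv_mul_eq_div, le_div_iff₀ hα]
  rcases (norm_nonneg (j v)).eq_or_lt with h0 | h0
  · rw [← h0]; simp
  · nlinarith

/-- Coercivity controls `j v`, and the equation then controls `s v`. The whole graph norm is thus
bounded by the image, which gives injectivity and closed range. -/
theorem bijective_of_accretive_of_orthogonal {j s : V →L[ℝ] U}
    (hnorm : ∀ v, ‖v‖ ≤ ‖j v‖ + ‖s v‖) (hacc : ∀ v, inner ℝ (s v) (j v) ≤ 0)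
    {M : U →L[ℝ] U} {α : ℝ} (hα : 0 < α) (hM : ∀ u, α * ‖u‖ ^ 2 ≤ inner ℝ (M u) u)
    (horth : ∀ w : U, (∀ v, inner ℝ w (M (j v) - s v) = 0) → w = 0) :
    Function.Bijective (M ∘L j - s) := by
  have hC : ∀ v, ‖v‖ ≤ (α⁻¹ + (1 + ‖M‖ * α⁻¹)) * ‖(M ∘L j - s) v‖ := by
    intro v
    have h1 := norm_le_of_accretive hacc hα hM v
    have h2 : ‖s v‖ ≤ ‖M (j v)‖ + ‖M (j v) - s v‖ := by
      have := norm_sub_le (M (j v)) (M (j v) - s v)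
      rwa [sub_sub_cancel] at this
    have h3 := M.le_opNorm (j v)
    have h4 : ‖M‖ * ‖j v‖ ≤ ‖M‖ * (α⁻¹ * ‖M (j v) - s v‖) := by gcongr
    have := hnorm v
    simp only [sub_apply, ContinuousLinearMap.comp_apply]
    nlinarith
  refine ⟨?_, surjective_of_bound_of_orthogonal _ _ hC horth⟩
  rw [injective_iff_map_eq_zero]
  intro v hv
  have := hC v
  rw [hv, norm_zero, mul_zero] at this
  exact norm_le_zero_iff.1 this

/-- If `-s` is accretive and `λ j - s` has dense range for all `λ > 0`, then `M j - s` is bijective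
for every bounded coercive `M`. -/
theorem bijective_of_accretive {j s : V →L[ℝ] U}
    (hnorm : ∀ v, ‖v‖ ≤ ‖j v‖ + ‖s v‖) (hacc : ∀ v, inner ℝ (s v) (j v) ≤ 0)
    (hdense : ∀ l : ℝ, 0 < l → ∀ w : U, (∀ v, inner ℝ w (l • j v - s v) = 0) → w = 0)
    {M : U →L[ℝ] U} {α : ℝ} (hα : 0 < α) (hM : ∀ u, α * ‖u‖ ^ 2 ≤ inner ℝ (M u) u) :
    Function.Bijective (M ∘L j - s) := by
  -- With this `l`, `‖(l - M) x‖² ≤ (l² - 2 l α + ‖M‖²) ‖x‖² = (l² - ‖M‖² - 2) ‖x‖²`, so `l - M` has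
  -- norm below `l`, while the inverse of `l j - s`, followed by `j`, has norm at most `1 / l`.
  set l : ℝ := (‖M‖ ^ 2 + 1) / α with hl
  have hl0 : 0 < l := by positivity
  have hlα : l * α = ‖M‖ ^ 2 + 1 := by rw [hl]; field_simp
  have hid : ∀ u : U, l * ‖u‖ ^ 2 ≤ inner ℝ ((l • ContinuousLinearMap.id ℝ U) u) u := by
    intro u
    simp [inner_smul_left]
  have hsurj := (bijective_of_accretive_of_orthogonal hnorm hacc hl0 hid
    (by simpa using hdense l hl0)).2
  refine bijective_of_accretive_of_orthogonal hnorm hacc hα hM fun w hw => ?_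
  obtain ⟨v, hv⟩ := hsurj w
  have hv' : l • j v - s v = w := by simpa using hv
  have h1 : l * ‖j v‖ ≤ ‖w‖ := by
    have := norm_le_of_accretive hacc hl0 hid v
    simp only [smul_apply, ContinuousLinearMap.id_apply, hv'] at this
    rwa [inv_mul_eq_div, le_div_iff₀ hl0, mul_comm] at this
  have h2 : ‖l • j v - M (j v)‖ ^ 2 ≤ (l ^ 2 - ‖M‖ ^ 2 - 2) * ‖j v‖ ^ 2 := by
    rw [norm_sub_sq_real, inner_smul_left, norm_smul]
    have h3 := hM (j v)
    have h4 : ‖M (j v)‖ ^ 2 ≤ (‖M‖ * ‖j v‖) ^ 2 := by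
      gcongr; exact M.le_opNorm _
    rw [real_inner_comm] at h3
    have h5 : l * (α * ‖j v‖ ^ 2) ≤ l * inner ℝ (j v) (M (j v)) := by gcongr
    rw [← mul_assoc, hlα] at h5
    simp only [Real.norm_eq_abs, mul_pow, sq_abs, conj_trivial]
    nlinarith
  -- Since `w = l j v - s v` is orthogonal to `M (j v) - s v`, pairing it with itself leaves only
  -- `(l - M) j v`. Hence `l ‖j v‖ ≤ ‖w‖ ≤ ‖(l - M) j v‖`, which forces `j v = 0`.
  have h6 : ‖w‖ ^ 2 = inner ℝ w (l • j v - M (j v)) := by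
    have h7 := hw v
    have h8 : l • j v - M (j v) = w - (M (j v) - s v) := by rw [← hv']; abel
    rw [h8, inner_sub_right, h7, sub_zero, real_inner_self_eq_norm_sq]
  have h9 := real_inner_le_norm w (l • j v - M (j v))
  rw [← h6] at h9
  by_contra hne
  have hw0 : 0 < ‖w‖ := norm_pos_iff.2 hne
  have h10 : ‖w‖ ≤ ‖l • j v - M (j v)‖ := by nlinarith
  have h11 : ‖w‖ ^ 2 ≤ ‖l • j v - M (j v)‖ ^ 2 := by gcongr
  have h12 : (l * ‖j v‖) ^ 2 ≤ ‖w‖ ^ 2 := by gcongr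
  have h13 : ‖j v‖ ^ 2 = 0 := by nlinarith [sq_nonneg ‖j v‖, sq_nonneg ‖M‖]
  nlinarith

end Abstract

/-! ### The error-controlled loop -/

section Loop

variable {d : ℕ} {D : Set (Space d)}

theorem summable_zetaSum {β : ℝ} (hβ : 1 < β) : Summable fun j : ℕ => ((j : ℝ) + 1) ^ (-β) := by
  have h : Summable fun n : ℕ => (n : ℝ) ^ (-β) := Real.summable_nat_rpow.2 (by linarith)
  have := (summable_nat_add_iff 1).2 h
  simpa using this

theorem sum_le_zetaSum {β : ℝ} (hβ : 1 < β) (n : ℕ) :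
    ∑ j ∈ Finset.range n, ((j : ℝ) + 1) ^ (-β) ≤ zetaSum β :=
  (summable_zetaSum hβ).sum_le_tsum _ fun _ _ => by positivity

theorem zetaSum_nonneg (β : ℝ) : 0 ≤ zetaSum β := tsum_nonneg fun _ => by positivity

theorem tol_pos (β : ℝ) {ρ : ℝ} (hρ : 0 < ρ) (n : ℕ) : 0 < tol β ρ n := by
  unfold tol; positivity

theorem runLoop_of_le {ε : ℝ} {step : LoopState D → Part (LoopState D)} {s : LoopState D}
    (h : s.err ≤ ε) : s.u ∈ runLoop ε step s := by
  refine PFun.fix_stop ?_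
  simp [not_lt.2 h]

theorem runLoop_of_lt {ε : ℝ} {step : LoopState D → Part (LoopState D)} {s s' : LoopState D}
    (h : ε < s.err) (hs : s' ∈ step s) : runLoop ε step s = runLoop ε step s' := by
  refine PFun.fix_fwd_eq ?_
  simp [h, hs]

/-- A loop with an invariant whose errors are eventually small terminates. -/
theorem exists_mem_runLoop {ε : ℝ} {step : LoopState D → Part (LoopState D)}
    (Inv : LoopState D → Prop)
    (hstep : ∀ s, Inv s → ∃ s' ∈ step s, Inv s' ∧ s'.n = s.n + 1)
    (N : ℕ) (hN : ∀ s, Inv s → N ≤ s.n → s.err ≤ ε) (s : LoopState D) (hs : Inv s) :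
    ∃ t, Inv t ∧ t.err ≤ ε ∧ t.u ∈ runLoop ε step s := by
  induction h : N - s.n generalizing s with
  | zero => exact ⟨s, hs, hN s hs (by omega), runLoop_of_le (hN s hs (by omega))⟩
  | succ k ih =>
    by_cases hε : s.err ≤ ε
    · exact ⟨s, hs, hε, runLoop_of_le hε⟩
    · obtain ⟨s', hs', hI, hn⟩ := hstep s hs
      obtain ⟨t, ht, htε, hmem⟩ := ih s' hI (by omega)
      exact ⟨t, ht, htε, by rwa [runLoop_of_lt (not_le.1 hε) hs']⟩

/-- Perturbed fixed-point iterations with contraction number `ρ` and tolerances `δ (1+n)^{-β} ρⁿ`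
terminate with the target accuracy. -/
theorem runLoop_iteration {β ρ δ ε b₀ : ℝ} (hβ : 1 < β) (hρ : 0 < ρ) (hρ1 : ρ < 1) (hδ : 0 ≤ δ)
    (hε : 0 < ε) {u : TrialSpace D} (hb : ‖u‖ ≤ b₀) {step : LoopState D → Part (LoopState D)}
    (hstep : ∀ s : LoopState D, ∃ u' : TrialSpace D,
      (⟨s.n + 1, u', (ρ * s.b + δ * zetaSum β) * ρ ^ s.n,
        min s.b (‖u'‖ + (ρ * s.b + δ * zetaSum β) * ρ ^ ((s.n : ℤ) - 1))⟩ : LoopState D) ∈ step s ∧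
      ‖u - u'‖ ≤ ρ * ‖u - s.u‖ + δ * tol β ρ s.n) :
    ∃ r ∈ runLoop ε step ⟨0, 0, b₀, b₀⟩, ‖u - r‖ ≤ ε := by
  have hζ := zetaSum_nonneg β
  -- The fourth clause is the error estimate multiplied by `ρ`; undivided, it makes sense at `n = 0`
  -- without a negative exponent. The last clause leaves out `n = 0`, where `err` is `b₀` itself.
  -- Together with `b ≤ b₀` it puts `err` below a fixed geometric sequence.
  let Inv : LoopState D → Prop := fun s =>
    ‖u - s.u‖ ≤ s.err ∧ ‖u‖ ≤ s.b ∧ s.b ≤ b₀ ∧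
    ρ * ‖u - s.u‖ ≤ ρ ^ s.n * (ρ * ‖u‖ + δ * ∑ k ∈ Finset.range s.n, ((k : ℝ) + 1) ^ (-β)) ∧
    (s.n ≠ 0 → s.err ≤ (ρ * b₀ + δ * zetaSum β) * ρ ^ (s.n - 1))
  have hInv0 : Inv ⟨0, 0, b₀, b₀⟩ := by
    refine ⟨by simpa using hb, hb, le_rfl, by simp, fun h => absurd rfl h⟩
  have hInv : ∀ s, Inv s → ∃ s' ∈ step s, Inv s' ∧ s'.n = s.n + 1 := by
    rintro s ⟨h1, h2, h3, h4, -⟩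
    obtain ⟨u', hmem, hu'⟩ := hstep s
    refine ⟨_, hmem, ?_, rfl⟩
    have hρn : 0 < ρ ^ s.n := by positivity
    have hsum := sum_le_zetaSum hβ (s.n + 1)
    have hb0 : 0 ≤ s.b := (norm_nonneg u).trans h2
    have key : ‖u - u'‖ ≤ ρ ^ s.n *
        (ρ * ‖u‖ + δ * ∑ k ∈ Finset.range (s.n + 1), ((k : ℝ) + 1) ^ (-β)) := by
      refine hu'.trans ?_
      rw [Finset.sum_range_succ]
      have : tol β ρ s.n = ((s.n : ℝ) + 1) ^ (-β) * ρ ^ s.n := by rw [tol, add_comm]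
      rw [this]
      nlinarith
    have herr : ‖u - u'‖ ≤ (ρ * s.b + δ * zetaSum β) * ρ ^ s.n := by
      refine key.trans ?_
      rw [mul_comm]
      gcongr
    refine ⟨herr, ?_, (min_le_left _ _).trans h3, ?_, fun _ => ?_⟩
    · refine le_min h2 ?_
      have h5 : ‖u‖ ≤ ‖u'‖ + ‖u - u'‖ := by
        have := norm_add_le u' (u - u')
        rwa [add_sub_cancel] at this
      -- The update of `b` uses the exponent `n - 1`, weaker than the error bound just proved, so
      -- `b` remains an upper bound. In the first pass the exponent is `-1`, hence the integer
      -- power.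
      have h6 : ρ ^ s.n ≤ ρ ^ ((s.n : ℤ) - 1) := by
        rw [← zpow_natCast]
        exact zpow_le_zpow_right_of_le_one₀ hρ hρ1.le (by omega)
      have h7 : (ρ * s.b + δ * zetaSum β) * ρ ^ s.n
          ≤ (ρ * s.b + δ * zetaSum β) * ρ ^ ((s.n : ℤ) - 1) := by gcongr
      linarith
    · have : ρ * ‖u - u'‖ ≤ ρ * (ρ ^ s.n *
        (ρ * ‖u‖ + δ * ∑ k ∈ Finset.range (s.n + 1), ((k : ℝ) + 1) ^ (-β))) := by gcongr
      rw [← mul_assoc, ← pow_succ'] at this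
      exact this
    · simp only [add_tsub_cancel_right]
      gcongr
  obtain ⟨N, hN⟩ : ∃ N : ℕ, (ρ * b₀ + δ * zetaSum β) * ρ ^ N ≤ ε := by
    have := (tendsto_pow_atTop_nhds_zero_of_lt_one hρ.le hρ1).const_mul (ρ * b₀ + δ * zetaSum β)
    rw [mul_zero] at this
    exact (this.eventually (ge_mem_nhds hε)).exists
  -- The bound for `err` at counter `n` carries `ρ ^ (n - 1)`, hence `N + 1`.
  obtain ⟨t, ht, htε, hmem⟩ := exists_mem_runLoop (ε := ε) Inv hInv (N + 1) (by
    rintro s ⟨-, h2, h3, -, h5⟩ hn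
    refine (h5 (by omega)).trans (le_trans ?_ hN)
    have hb0 : 0 ≤ b₀ := (norm_nonneg u).trans hb
    have : ρ ^ (s.n - 1) ≤ ρ ^ N := pow_le_pow_of_le_one hρ.le hρ1.le (by omega)
    gcongr) _ hInv0
  exact ⟨t.u, hmem, ht.1.trans htε⟩

/-- One step of the perturbed fixed-point iteration for `u = S (k u + f)`. -/
theorem norm_sub_le_of_perturbed_step {E F : Type*} [NormedAddCommGroup E]
    [NormedAddCommGroup F] (S : F → E) (hS : ∀ x y, S (x + y) = S x + S y) (k : E → F)
    (hk : ∀ x y, k (x + y) = k x + k y) (hsurj : Function.Surjective S)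
    {C q η κ₁ κ₂ κ₃ : ℝ} (hη : 0 < η) (hq : 0 < q) (hC : ∀ g, ‖S g‖ ≤ C * ‖g‖)
    (hweights : C * (κ₁ + κ₂) + κ₃ ≤ 1) (hcontr : ∀ w, ‖S (k w)‖ ≤ q * ‖w‖)
    {f wk g : F} {u w t : E} (hu : u = S (k u + f)) (hwk : ‖k w - wk‖ ≤ κ₁ * η)
    (hg : ‖f - g‖ ≤ κ₂ * η) (ht : ‖t - S (wk + g)‖ ≤ κ₃ * η) :
    ‖u - t‖ ≤ q * ‖u - w‖ + η := by
  have hSs : ∀ x y, S (x - y) = S x - S y := (AddMonoidHom.mk' S hS).map_sub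
  have hks : ∀ x y, k (x - y) = k x - k y := (AddMonoidHom.mk' k hk).map_sub
  -- The sign of `C` is not prescribed. As `S` is onto, a negative `C` is possible only if every
  -- norm in `E` vanishes.
  rcases le_or_gt 0 C with h0 | h0
  · have hdecomp : u - t = S (k (u - w)) + S (k w - wk) + S (f - g) - (t - S (wk + g)) := by
      conv_lhs => rw [hu]
      simp only [hS, hSs, hks]
      abel
    have htri : ‖u - t‖ ≤ ‖S (k (u - w))‖ + ‖S (k w - wk)‖ + ‖S (f - g)‖
        + ‖t - S (wk + g)‖ := by
      rw [hdecomp]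
      exact (norm_sub_le _ _).trans (add_le_add (norm_add₃_le ..) le_rfl)
    have h1 := hcontr (u - w)
    have h3 := (hC (k w - wk)).trans (mul_le_mul_of_nonneg_left hwk h0)
    have h4 := (hC (f - g)).trans (mul_le_mul_of_nonneg_left hg h0)
    have h5 := mul_le_mul_of_nonneg_right hweights hη.le
    linarith
  · obtain ⟨x, hx⟩ := hsurj (u - t)
    have h1 : ‖u - t‖ ≤ 0 := by
      rw [← hx]
      exact (hC x).trans (mul_nonpos_of_nonpos_of_nonneg h0.le (norm_nonneg _))
    exact h1.trans (by positivity)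

/-- What the analysis of ASTI needs to know about the transport equation: `S = 𝒯⁻¹`, `k = 𝒦`. -/
structure IsTransportInverse (c : Optics d) (S : DualSpace D → TrialSpace D)
    (k : TrialSpace D → DualSpace D) : Prop where
  map_add : ∀ g h, S (g + h) = S g + S h
  scatter_add : ∀ v w, k (v + w) = k v + k w
  surjective : Function.Surjective S
  transport : ∀ g, c.IsTransportSolution g (S g)
  scatter_eq : ∀ w v, c.scatterForm w v = k w v
  solution : ∀ f u, c.IsSolution f u → u = S (k u + f)
  contraction : ∀ w, ‖S (k w)‖ ≤ c.contractionBound D * ‖w‖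

theorem norm_sub_astiStep_le {A : AstiData D} {c : Optics d} (hA : A.Admissible c)
    {S : DualSpace D → TrialSpace D} {k : TrialSpace D → DualSpace D}
    (hS : IsTransportInverse c S k) {f : DualSpace D} {u : TrialSpace D}
    (hu : c.IsSolution f u) (s : LoopState D) :
    ‖u - (astiStep A f s).u‖ ≤ A.ρ * ‖u - s.u‖ + tol A.β A.ρ s.n := by
  have hη : 0 < tol A.β A.ρ s.n := tol_pos _ hA.pos_ρ _
  -- These are exactly the tolerances for which the routines guarantee anything: positive ones, and
  -- zero in the case of exact evaluation.
  have hκ : ∀ κ : ℝ, 0 ≤ κ → (0 < κ * tol A.β A.ρ s.n ∨ (κ * tol A.β A.ρ s.n = 0 ∧ κ = 0)) := by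
    intro κ hκ
    rcases hκ.eq_or_lt with h | h
    · right; simp [← h]
    · left; positivity
  have hwk : ‖k s.u - A.applyK s.u (A.κ₁ * tol A.β A.ρ s.n)‖ ≤ A.κ₁ * tol A.β A.ρ s.n := by
    refine ContinuousLinearMap.opNorm_le_bound _ (mul_nonneg hA.nonneg_κ₁ hη.le) fun v => ?_
    have := hA.applyK_spec s.u _ (hκ _ hA.nonneg_κ₁) v
    rw [hS.scatter_eq] at this
    exact this
  have hg := hA.approx_spec f _ (hκ _ hA.nonneg_κ₂)
  have ht := hA.solveT_spec (A.applyK s.u (A.κ₁ * tol A.β A.ρ s.n)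
    + A.approx f (A.κ₂ * tol A.β A.ρ s.n)) _ (hκ _ hA.nonneg_κ₃) _ (hS.transport _)
  have hC : ∀ g, ‖S g‖ ≤ A.C * ‖g‖ := fun g => hA.norm_inv_le g _ (hS.transport g)
  have hcontr : ∀ w, ‖S (k w)‖ ≤ A.ρ * ‖w‖ := fun w =>
    (hS.contraction w).trans (mul_le_mul_of_nonneg_right hA.bound_le_ρ (norm_nonneg _))
  exact norm_sub_le_of_perturbed_step (E := TrialSpace D) (F := DualSpace D) S hS.map_add k
    hS.scatter_add hS.surjective hη hA.pos_ρ hC hA.weights hcontr (hS.solution f u hu) hwk hg ht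

/-- ASTI terminates with the target accuracy. -/
theorem exists_mem_asti {A : AstiData D} {c : Optics d} (hA : A.Admissible c)
    {S : DualSpace D → TrialSpace D} {k : TrialSpace D → DualSpace D}
    (hS : IsTransportInverse c S k) {f : DualSpace D} {u : TrialSpace D}
    (hu : c.IsSolution f u) (hb : ‖u‖ ≤ A.b₀ f) {ε : ℝ} (hε : 0 < ε) :
    ∃ r ∈ asti A f ε, ‖u - r‖ ≤ ε := by
  refine runLoop_iteration hA.one_lt_β hA.pos_ρ hA.ρ_lt_one zero_le_one hε hb fun s => ?_
  refine ⟨(astiStep A f s).u, ?_, by simpa using norm_sub_astiStep_le hA hS hu s⟩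
  simp [astiStep]

/-- One step of the nested iteration, for `a u = a R u` up to a source, with `R` the solution
operator on `L₂`. -/
theorem norm_sub_le_of_nested_step {E : Type*} [NormedAddCommGroup E] [NormedSpace ℝ E]
    (R : E → E) {a q q' η : ℝ} (hq1 : q' ≤ 1) (ha : 0 < a)
    (hcontr : ∀ w, a * ‖R w‖ ≤ q' * ‖w‖) (hqq : q' ≤ q)
    {u w x y e : E} (hu : u - a • x = a • R (u - w) + a • R e) (heη : ‖e‖ ≤ η)
    (hy : ‖x - y‖ ≤ η) :
    ‖u - a • y‖ ≤ q * ‖u - w‖ + (1 + a) * η := by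
  have hdecomp : u - a • y = a • R (u - w) + a • R e + a • (x - y) := by
    rw [← hu, smul_sub]; abel
  have htri : ‖u - a • y‖ ≤ a * ‖R (u - w)‖ + a * ‖R e‖ + a * ‖x - y‖ := by
    rw [hdecomp]
    refine (norm_add₃_le ..).trans ?_
    simp only [norm_smul, Real.norm_eq_abs, abs_of_pos ha, le_refl]
  -- The iteration error is damped by `q`, the source error is merely not amplified, and the inner
  -- error is scaled by `a`. The last two make up the weight `1 + a`.
  have h1 := (hcontr (u - w)).trans (mul_le_mul_of_nonneg_right hqq (norm_nonneg _))
  have h2 := (hcontr e).trans (mul_le_mul_of_nonneg_right hq1 (norm_nonneg _))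
  have h3 := mul_le_mul_of_nonneg_left hy ha.le
  linarith

/-- The scattering-dominated branch terminates with the target accuracy. Here `R` is the solution
operator of the shifted equation. -/
theorem exists_mem_nested {N : NestedData D} {c : Optics d} {f : DualSpace D}
    (hN : N.Admissible c f) (hα : 0 < c.α)
    {S : DualSpace D → TrialSpace D} {k : TrialSpace D → DualSpace D}
    (hS : IsTransportInverse (c.shift N.a) S k)
    {R : DualSpace D → TrialSpace D} (hR : ∀ g, (c.shift N.a).IsSolution g (R g))
    (hb : ∀ g, ‖R g‖ ≤ N.inner.b₀ g)
    (hbound : ∀ w : TrialSpace D, ‖R (embed w)‖ ≤ (c.α + N.a)⁻¹ * ‖w‖)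
    {u : TrialSpace D}
    (hu : ∀ (w e : TrialSpace D) (g : DualSpace D), N.a⁻¹ • f - g = embed e →
      u - N.a • R (embed w + g) = N.a • R (embed (u - w)) + N.a • R (embed e))
    (hub : ‖u‖ ≤ N.b₀) {ε : ℝ} (hε : 0 < ε) :
    ∃ r ∈ runLoop ε (nestedStep N) ⟨0, 0, N.b₀, N.b₀⟩, ‖u - r‖ ≤ ε := by
  have ha := hN.pos_a
  have hρ : 0 < N.ρ := (by positivity : 0 < N.a / (N.a + c.α)).trans_le hN.left_le_ρ
  refine runLoop_iteration (δ := 1 + N.a) hN.one_lt_β hρ hN.ρ_lt_one (by positivity) hε hub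
    fun s => ?_
  have hη : 0 < tol N.β N.ρ s.n := tol_pos _ hρ _
  obtain ⟨e, he, heη⟩ := hN.approxSource_spec _ hη
  obtain ⟨y, hy, hyη⟩ := exists_mem_asti hN.inner_admissible hS
    (hR (embed s.u + N.approxSource (tol N.β N.ρ s.n))) (hb _) hη
  refine ⟨N.a • y, Part.mem_map_iff _ |>.2 ⟨y, hy, rfl⟩, ?_⟩
  -- The contraction number is `a` times the stability constant of the shifted equation.
  refine norm_sub_le_of_nested_step (fun w => R (embed w)) (q' := N.a / (N.a + c.α)) ?_ ha
    (fun w => ?_) hN.left_le_ρ (hu s.u e _ he) heη hyη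
  · rw [div_le_one (by positivity)]; linarith
  · refine (mul_le_mul_of_nonneg_left (hbound w) ha.le).trans_eq ?_
    rw [add_comm c.α, ← mul_assoc, div_eq_mul_inv]

end Loop

/-! ### Exit points of a convex domain -/

section Geometry

open Filter Topology

variable {d : ℕ} {D : Set (Space d)}

/-- The length of the ray from `x` in direction `s` up to the boundary of `D`. -/
def exitTime (D : Set (Space d)) (s x : Space d) : ℝ := sSup {t : ℝ | x + t • s ∈ closure D}

theorem isCompact_exitSet (hb : Bornology.IsBounded D) {s : Space d} (hs : ‖s‖ = 1)
    (x : Space d) : IsCompact {t : ℝ | x + t • s ∈ closure D} := by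
  refine Metric.isCompact_of_isClosed_isBounded
    (isClosed_closure.preimage (by fun_prop : Continuous fun t : ℝ => x + t • s)) ?_
  obtain ⟨C, hC⟩ := hb.closure.exists_norm_le
  refine isBounded_iff_forall_norm_le.2 ⟨C + ‖x‖, fun t ht => ?_⟩
  have h1 : ‖t • s‖ ≤ ‖x + t • s‖ + ‖x‖ := by
    have := norm_sub_le (x + t • s) x
    rwa [add_sub_cancel_left] at this
  rw [norm_smul, hs, mul_one] at h1
  linarith [hC _ ht]

theorem exitTime_mem (hb : Bornology.IsBounded D) {s : Space d} (hs : ‖s‖ = 1) {x : Space d}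
    (hx : x ∈ D) : x + exitTime D s x • s ∈ closure D :=
  (isCompact_exitSet hb hs x).sSup_mem ⟨0, by simpa using subset_closure hx⟩

theorem le_exitTime (hb : Bornology.IsBounded D) {s : Space d} (hs : ‖s‖ = 1) {x : Space d}
    {t : ℝ} (h : x + t • s ∈ closure D) : t ≤ exitTime D s x :=
  le_csSup (isCompact_exitSet hb hs x).bddAbove h

theorem exitTime_nonneg (hb : Bornology.IsBounded D) {s : Space d} (hs : ‖s‖ = 1) {x : Space d}
    (hx : x ∈ D) : 0 ≤ exitTime D s x :=
  le_exitTime hb hs (by simpa using subset_closure hx)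

theorem exit_mem_frontier (ho : IsOpen D) (hb : Bornology.IsBounded D) {s : Space d}
    (hs : ‖s‖ = 1) {x : Space d} (hx : x ∈ D) : x + exitTime D s x • s ∈ frontier D := by
  refine ⟨exitTime_mem hb hs hx, fun hint => ?_⟩
  rw [ho.interior_eq] at hint
  have hopen : IsOpen {t : ℝ | x + t • s ∈ D} :=
    ho.preimage (by fun_prop : Continuous fun t : ℝ => x + t • s)
  have h1 : ∀ᶠ t in 𝓝[>] (exitTime D s x), x + t • s ∈ D :=
    nhdsWithin_le_nhds (hopen.mem_nhds hint)
  obtain ⟨t, ht, hlt⟩ := (h1.and self_mem_nhdsWithin).exists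
  exact absurd (le_exitTime hb hs (subset_closure ht)) (not_le.2 hlt)

/-- A point strictly before the exit point is a combination, with positive weight on `x`, of an
interior point and a point of the closure, hence interior. -/
theorem exitTime_le_of_notMem (ho : IsOpen D) (hb : Bornology.IsBounded D) (hc : Convex ℝ D)
    {s : Space d} (hs : ‖s‖ = 1) {x : Space d} (hx : x ∈ D) {t : ℝ} (ht : 0 ≤ t)
    (h : x + t • s ∉ D) : exitTime D s x ≤ t := by
  by_contra! hlt
  refine h ?_
  have hpos : 0 < exitTime D s x := ht.trans_lt hlt
  have := hc.combo_interior_closure_mem_interior (x := x) (by rwa [ho.interior_eq])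
    (exitTime_mem hb hs hx) (a := 1 - t / exitTime D s x) (b := t / exitTime D s x)
    (by rw [sub_pos, div_lt_one hpos]; exact hlt) (by positivity) (by ring)
  rw [ho.interior_eq] at this
  convert this using 1
  rw [smul_add, smul_smul, div_mul_cancel₀ _ hpos.ne', sub_smul, one_smul]
  abel

/-- A convex combination of two exit points is still in the closure and lies on the ray from the
combined starting point. Concavity yields local Lipschitz continuity without any regularity of `∂D`.
-/
theorem concaveOn_exitTime (hb : Bornology.IsBounded D) (hc : Convex ℝ D)
    {s : Space d} (hs : ‖s‖ = 1) : ConcaveOn ℝ D (exitTime D s) := by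
  refine ⟨hc, fun x hx y hy a b ha hb' hab => le_exitTime hb hs ?_⟩
  have := hc.closure (exitTime_mem hb hs hx) (exitTime_mem hb hs hy) ha hb' hab
  convert this using 1
  simp only [smul_add, smul_smul, add_smul, smul_eq_mul]
  abel

/-- A locally Lipschitz function on an open set is differentiable almost everywhere. -/
theorem ae_differentiableAt_of_locallyLipschitzOn (ho : IsOpen D) {g : Space d → ℝ}
    (hg : LocallyLipschitzOn D g) : ∀ᵐ x, x ∈ D → DifferentiableAt ℝ g x := by
  rw [ae_iff]
  refine measure_null_of_locally_null _ fun x hx => ?_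
  simp only [Set.mem_ofPred_eq, Classical.not_imp] at hx
  obtain ⟨K, t, ht, hK⟩ := hg hx.1
  rw [ho.nhdsWithin_eq hx.1] at ht
  obtain ⟨u, hut, huo, hxu⟩ := mem_nhds_iff.1 ht
  refine ⟨{a | ¬(a ∈ D → DifferentiableAt ℝ g a)} ∩ u,
    Filter.inter_mem self_mem_nhdsWithin (nhdsWithin_le_nhds (huo.mem_nhds hxu)), ?_⟩
  have h := (hK.mono hut).ae_differentiableWithinAt_of_mem (μ := volume)
  refine measure_mono_null ?_ (ae_iff.1 h)
  rintro y ⟨hy, hyu⟩ h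
  simp only [Set.mem_ofPred_eq, Classical.not_imp] at hy
  exact hy.2 ((h hyu).differentiableAt (huo.mem_nhds hyu))

theorem ae_differentiableAt_exitTime (ho : IsOpen D) (hb : Bornology.IsBounded D)
    (hc : Convex ℝ D) {s : Space d} (hs : ‖s‖ = 1) :
    ∀ᵐ x, x ∈ D → DifferentiableAt ℝ (exitTime D s) x :=
  ae_differentiableAt_of_locallyLipschitzOn ho ((concaveOn_exitTime hb hc hs).locallyLipschitzOn ho)

/-- A boundary point of an open convex set has an outer unit normal. -/
theorem exists_isOuterNormal (ho : IsOpen D) (hc : Convex ℝ D) (hne : D.Nonempty) {p : Space d}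
    (hp : p ∉ D) : ∃ n, IsOuterNormal D p n := by
  obtain ⟨g, hg⟩ := geometric_hahn_banach_open_point hc ho hp
  set n₀ := (InnerProductSpace.toDual ℝ (Space d)).symm g with hn₀
  have hn : ∀ y, inner ℝ n₀ y = g y := fun y => InnerProductSpace.toDual_symm_apply
  obtain ⟨y, hy⟩ := hne
  have h0 : 0 < ‖n₀‖ := by
    rw [norm_pos_iff]
    intro h
    have h1 := hg y hy
    rw [← hn, ← hn, h] at h1
    simp at h1
  refine ⟨‖n₀‖⁻¹ • n₀, by rw [norm_smul, norm_inv, norm_norm, inv_mul_cancel₀ h0.ne'], ?_⟩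
  intro y hy
  rw [real_inner_smul_left, hn, map_sub]
  exact mul_nonpos_of_nonneg_of_nonpos (by positivity) (by linarith [hg y hy])

/-- For small `e > 0` the point `x + e n` is in `D`, and the supporting half-space at the exit point
then gives `e ≤ τ (s · n)`, where `τ ≥ 0` is the exit time. -/
theorem inner_pos_of_isOuterNormal_exit (ho : IsOpen D) (hb : Bornology.IsBounded D)
    {s : Space d} (hs : ‖s‖ = 1) {x n : Space d} (hx : x ∈ D)
    (hn : IsOuterNormal D (x + exitTime D s x • s) n) : 0 < inner ℝ s n := by
  have hev : ∀ᶠ e : ℝ in 𝓝[>] 0, x + e • n ∈ D := by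
    have hopen : IsOpen {t : ℝ | x + t • n ∈ D} :=
      ho.preimage (by fun_prop : Continuous fun t : ℝ => x + t • n)
    exact nhdsWithin_le_nhds (hopen.mem_nhds (by simpa using hx))
  obtain ⟨e, he, hpos⟩ := (hev.and self_mem_nhdsWithin).exists
  have h1 := hn.2 _ he
  have h2 : x + e • n - (x + exitTime D s x • s) = e • n - exitTime D s x • s := by abel
  rw [h2, inner_sub_right, real_inner_smul_right, real_inner_smul_right,
    real_inner_self_eq_norm_sq, hn.1, real_inner_comm] at h1
  have h3 := exitTime_nonneg hb hs hx
  have hpos' : 0 < e := hpos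
  by_contra! h4
  nlinarith

/-- If the exit time is differentiable at `x`, the exit point of the ray from `x` lies on the
outflow boundary. -/
theorem exit_mem_outflow (ho : IsOpen D) (hb : Bornology.IsBounded D) (hc : Convex ℝ D)
    {s : Space d} (hs : ‖s‖ = 1) {x : Space d} (hx : x ∈ D)
    (hdiff : DifferentiableAt ℝ (exitTime D s) x) :
    (x + exitTime D s x • s, s) ∈ outflow D := by
  have hfr := exit_mem_frontier ho hb hs hx
  have hpD : x + exitTime D s x • s ∉ D := by
    have := hfr.2
    rwa [ho.interior_eq] at this
  obtain ⟨n, hn⟩ := exists_isOuterNormal ho hc ⟨x, hx⟩ hpD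
  -- All exit points lie in the half-space of `m`, and the one from `x` lies on its boundary. So `(s
  -- · m) τ(z) + m · z` is maximal at `z = x`, and `m = -(s · m) ∇τ(x)`. Two unit normals are then
  -- positive multiples of each other, hence equal.
  have hgrad : ∀ m, IsOuterNormal D (x + exitTime D s x • s) m → ∀ y,
      inner ℝ s m * fderiv ℝ (exitTime D s) x y + inner ℝ m y = 0 := by
    intro m hm y
    have hF : HasFDerivAt (fun z => inner ℝ s m * exitTime D s z + inner ℝ m z)
        (inner ℝ s m • fderiv ℝ (exitTime D s) x + innerSL ℝ m) x :=
      (hdiff.hasFDerivAt.const_mul _).add (innerSL ℝ m).hasFDerivAt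
    have hmax : IsLocalMax (fun z => inner ℝ s m * exitTime D s z + inner ℝ m z) x := by
      filter_upwards [ho.mem_nhds hx] with z hz
      have hclos : inner ℝ m (z + exitTime D s z • s - (x + exitTime D s x • s)) ≤ 0 := by
        have hcl : IsClosed {y | inner ℝ m (y - (x + exitTime D s x • s)) ≤ 0} :=
          isClosed_le (by fun_prop) continuous_const
        exact closure_minimal hm.2 hcl (exitTime_mem hb hs hz)
      rw [inner_sub_right, inner_add_right, inner_add_right, real_inner_smul_right,
        real_inner_smul_right, real_inner_comm s m] at hclos
      linarith
    have := hmax.hasFDerivAt_eq_zero hF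
    simpa using congrArg (fun A => A y) this
  refine ⟨hfr, hs, n, hn, fun m hm => ?_, inner_pos_of_isOuterNormal_exit ho hb hs hx hn⟩
  have hn0 := inner_pos_of_isOuterNormal_exit ho hb hs hx hn
  have hm0 := inner_pos_of_isOuterNormal_exit ho hb hs hx hm
  have heq : inner ℝ s n • m = inner ℝ s m • n := by
    refine ext_inner_right ℝ fun y => ?_
    rw [real_inner_smul_left, real_inner_smul_left]
    have h1 := hgrad n hn y
    have h2 := hgrad m hm y
    linear_combination inner ℝ s n * h2 - inner ℝ s m * h1
  have hnorm := congrArg norm heq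
  rw [norm_smul, norm_smul, hn.1, hm.1, mul_one, mul_one, Real.norm_of_nonneg hn0.le,
    Real.norm_of_nonneg hm0.le] at hnorm
  rw [hnorm] at heq
  exact smul_right_injective _ hm0.ne' heq

/-- Each point of the open set `D` stays in `D` under small shifts, so dominated convergence
applies. -/
theorem tendsto_measure_leaving (ho : IsOpen D) (hb : Bornology.IsBounded D) (s : Space d) :
    Tendsto (fun t : ℝ => (volume.restrict D).real {x | x + t • s ∉ D}) (𝓝 0) (𝓝 0) := by
  have : IsFiniteMeasure (volume.restrict D) :=
    isFiniteMeasure_restrict.2 hb.measure_lt_top.ne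
  have hmeas : ∀ t : ℝ, MeasurableSet {x | x + t • s ∉ D} := fun t =>
    (ho.preimage (by fun_prop : Continuous fun x => x + t • s)).measurableSet.compl
  have hlim := tendsto_integral_filter_of_dominated_convergence (μ := volume.restrict D)
    (F := fun t : ℝ => Set.indicator {x | x + t • s ∉ D} fun _ => (1 : ℝ)) (f := fun _ => 0)
    (l := 𝓝 0) (fun _ => 1)
    (Eventually.of_forall fun t =>
      (measurable_const.indicator (hmeas t)).aestronglyMeasurable)
    (Eventually.of_forall fun t => Eventually.of_forall fun x => by
      by_cases hx : x ∈ {x | x + t • s ∉ D} <;> simp [hx])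
    (integrable_const _)
    (by
      filter_upwards [ae_restrict_mem ho.measurableSet] with x hx
      have hopen : IsOpen {t : ℝ | x + t • s ∈ D} :=
        ho.preimage (by fun_prop : Continuous fun t : ℝ => x + t • s)
      refine tendsto_const_nhds.congr' ?_
      filter_upwards [hopen.mem_nhds (show (0 : ℝ) ∈ _ by simpa using hx)] with t ht
      have : x + t • s ∈ D := ht
      simp [this])
  simpa only [integral_indicator_const _ (hmeas _), integral_zero, smul_eq_mul, mul_one] using hlim

/-- A nonnegative `C¹` function that vanishes on the outflow part of the boundary decreases in
direction `s` on average. -/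
theorem integral_fderiv_nonpos (ho : IsOpen D) (hb : Bornology.IsBounded D) (hc : Convex ℝ D)
    {s : Space d} (hs : ‖s‖ = 1) {h : Space d → ℝ} (hh : ContDiff ℝ 1 h)
    (hpos : ∀ x ∈ D, 0 ≤ h x) (hzero : ∀ p, (p, s) ∈ outflow D → h p = 0) :
    ∫ x in D, fderiv ℝ h x s ≤ 0 := by
  have hfin : IsFiniteMeasure (volume.restrict D) :=
    isFiniteMeasure_restrict.2 hb.measure_lt_top.ne
  obtain ⟨R, hR⟩ := hb.closure.exists_norm_le
  obtain ⟨L, hL⟩ := (isCompact_closedBall (0 : Space d) (R + 1)).exists_bound_of_continuousOn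
    (hh.continuous_fderiv one_ne_zero).continuousOn
  obtain ⟨C, hC⟩ := (isCompact_closedBall (0 : Space d) (R + 1)).exists_bound_of_continuousOn
    hh.continuous.continuousOn
  have hmem : ∀ x ∈ D, ∀ t : ℝ, |t| ≤ 1 → x + t • s ∈ Metric.closedBall (0 : Space d) (R + 1) := by
    intro x hx t ht
    rw [mem_closedBall_zero_iff]
    refine (norm_add_le _ _).trans (add_le_add (hR x (subset_closure hx)) ?_)
    rw [norm_smul, hs, mul_one]
    exact ht
  have hlip : ∀ x ∈ Metric.closedBall (0 : Space d) (R + 1),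
      ∀ y ∈ Metric.closedBall (0 : Space d) (R + 1), ‖h y - h x‖ ≤ L * ‖y - x‖ := by
    intro x hx y hy
    exact (convex_closedBall _ _).norm_image_sub_le_of_norm_fderiv_le
      (fun z _ => hh.differentiable one_ne_zero z) hL hx hy
  -- The integral in question is the derivative at `0` of a shifted integral, so it suffices to
  -- bound the difference quotients for `t > 0`.
  have hderiv : HasDerivAt (fun t : ℝ => ∫ x in D, h (x + t • s)) (∫ x in D, fderiv ℝ h x s) 0 := by
    have hline : ∀ (x : Space d) (t : ℝ), HasDerivAt (fun t : ℝ => h (x + t • s))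
        (fderiv ℝ h (x + t • s) s) t := by
      intro x t
      have h1 : HasDerivAt (fun t : ℝ => x + t • s) s t := by
        simpa using ((hasDerivAt_id t).smul_const s).const_add x
      exact (hh.differentiable one_ne_zero _).hasFDerivAt.comp_hasDerivAt t h1
    have := (hasDerivAt_integral_of_dominated_loc_of_deriv_le (μ := volume.restrict D)
      (F := fun (t : ℝ) x => h (x + t • s)) (F' := fun (t : ℝ) x => fderiv ℝ h (x + t • s) s)
      (x₀ := 0) (bound := fun _ => L) (Metric.ball_mem_nhds 0 one_pos)
      (Eventually.of_forall fun t =>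
        (hh.continuous.comp (by fun_prop)).aestronglyMeasurable) ?_
      (((hh.continuous_fderiv one_ne_zero).comp (by fun_prop)).clm_apply
        continuous_const).aestronglyMeasurable ?_ (integrable_const _)
      (Eventually.of_forall fun x t _ => hline x t)).2
    · simpa using this
    · refine Integrable.of_bound (hh.continuous.comp (by fun_prop)).aestronglyMeasurable C ?_
      filter_upwards [ae_restrict_mem ho.measurableSet] with x hx
      exact hC _ (hmem x hx 0 (by simp))
    · filter_upwards [ae_restrict_mem ho.measurableSet] with x hx t ht
      have h1 := (fderiv ℝ h (x + t • s)).le_opNorm s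
      rw [hs, mul_one] at h1
      have ht' : |t| ≤ 1 := by simpa using (Metric.mem_ball.1 ht).le
      exact h1.trans (hL _ (hmem x hx t ht'))
  have hint : IntegrableOn h D := by
    refine Integrable.of_bound hh.continuous.aestronglyMeasurable C ?_
    filter_upwards [ae_restrict_mem ho.measurableSet] with x hx
    simpa using hC _ (hmem x hx 0 (by simp))
  have hindint : Integrable (D.indicator h) := hint.integrable_indicator ho.measurableSet
  -- Points that stay in `D` contribute at most `∫_D h`, by translation invariance and `h ≥ 0`. For
  -- almost every point that leaves, `h` vanishes at an exit point at distance at most `t` from `x +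
  -- t s`, so `h (x + t s) ≤ L t`. The measure of the leaving set tends to zero, so the second
  -- contribution is `o(t)`.
  have hslope : ∀ t ∈ Set.Ioo (0 : ℝ) 1, ∫ x in D, h (x + t • s) ≤
      (∫ x in D, h x) + L * t * (volume.restrict D).real {x | x + t • s ∉ D} := by
    intro t ht
    have hmeas : MeasurableSet {x | x + t • s ∉ D} :=
      (ho.preimage (by fun_prop : Continuous fun x => x + t • s)).measurableSet.compl
    have h1 : ∫ x in D, D.indicator h (x + t • s) ≤ ∫ x in D, h x := by
      rw [← integral_indicator ho.measurableSet, ← integral_indicator ho.measurableSet,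
        ← integral_add_right_eq_self (D.indicator h) (t • s)]
      refine integral_mono_of_nonneg ?_ (hindint.comp_add_right (t • s)) ?_
      · refine Eventually.of_forall fun x => Set.indicator_nonneg (fun y _ => ?_) _
        exact Set.indicator_nonneg hpos _
      · refine Eventually.of_forall fun x => Set.indicator_le_self' (fun y _ => ?_) _
        exact Set.indicator_nonneg hpos _
    have h2 : ∫ x in D, h (x + t • s) ≤ ∫ x in D, (D.indicator h (x + t • s)
        + L * t * Set.indicator {x | x + t • s ∉ D} (fun _ => (1 : ℝ)) x) := by
      refine integral_mono_ae ?_ ?_ ?_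
      · refine Integrable.of_bound (hh.continuous.comp (by fun_prop)).aestronglyMeasurable C ?_
        filter_upwards [ae_restrict_mem ho.measurableSet] with x hx
        exact hC _ (hmem x hx t (by rw [abs_of_pos ht.1]; exact ht.2.le))
      · exact (hindint.comp_add_right (t • s)).restrict.add
          (((integrable_const (1 : ℝ)).indicator hmeas).const_mul _)
      · filter_upwards [ae_restrict_mem ho.measurableSet,
          ae_restrict_of_ae (ae_differentiableAt_exitTime ho hb hc hs)] with x hx hdiff
        by_cases hxt : x + t • s ∈ D
        · simp [hxt]
        · have h3 := exitTime_le_of_notMem ho hb hc hs hx ht.1.le hxt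
          have h4 := exitTime_nonneg hb hs hx
          have h5 := hzero _ (exit_mem_outflow ho hb hc hs hx (hdiff hx))
          have h6 := hlip _ (hmem x hx _ (by rw [abs_of_nonneg h4]; linarith [ht.2])) _
            (hmem x hx t (by rw [abs_of_pos ht.1]; exact ht.2.le))
          have h7 : x + t • s - (x + exitTime D s x • s) = (t - exitTime D s x) • s := by
            rw [sub_smul]; abel
          rw [h5, h7, norm_smul, hs, mul_one, sub_zero, 
            Real.norm_of_nonneg (show 0 ≤ t - exitTime D s x by linarith)] at h6
          have hL0 : 0 ≤ L := (norm_nonneg _).trans (hL _ (hmem x hx 0 (by simp)))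
          have h8 := (le_abs_self _).trans h6
          simp only [hxt, not_false_eq_true, Set.indicator_of_notMem, zero_add,
            Set.mem_ofPred_eq, Set.indicator_of_mem, mul_one]
          exact h8.trans (mul_le_mul_of_nonneg_left (by linarith) hL0)
    rw [integral_add (hindint.comp_add_right (t • s)).restrict
      (((integrable_const (1 : ℝ)).indicator hmeas).const_mul _), integral_const_mul,
      integral_indicator_const _ hmeas, smul_eq_mul, mul_one] at h2
    linarith
  have hsub : Set.Ioi (0 : ℝ) ⊆ {0}ᶜ := fun t ht => (Set.mem_Ioi.1 ht).ne'
  have hlim := (hasDerivAt_iff_tendsto_slope.1 hderiv).mono_left (nhdsWithin_mono 0 hsub)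
  have hlim2 : Tendsto (fun t : ℝ => L * (volume.restrict D).real {x | x + t • s ∉ D})
      (𝓝[>] 0) (𝓝 0) := by
    simpa using ((tendsto_measure_leaving ho hb s).const_mul L).mono_left nhdsWithin_le_nhds
  refine le_of_tendsto_of_tendsto hlim hlim2 ?_
  filter_upwards [Ioo_mem_nhdsGT one_pos] with t ht
  rw [slope_def_field, sub_zero, div_le_iff₀ ht.1]
  have := hslope t ht
  simp only [zero_smul, add_zero]
  linarith

end Geometry

/-! ### Energy inequalities -/

section Energy

open Filter Topology

variable {d : ℕ} {D : Set (Space d)}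

instance : IsFiniteMeasure (dirMeasure d) := by unfold dirMeasure; infer_instance

theorem inner_eq_integral (f g : TrialSpace D) :
    inner ℝ f g = ∫ z, f z * g z ∂(phaseMeasure D) := by
  rw [L2.inner_def]
  refine integral_congr_ae (Eventually.of_forall fun z => ?_)
  simp [mul_comm]

theorem integrable_mul (f g : TrialSpace D) :
    Integrable (fun z => f z * g z) (phaseMeasure D) := by
  refine (L2.integrable_inner (𝕜 := ℝ) f g).congr (Eventually.of_forall fun z => ?_)
  simp [mul_comm]

theorem norm_sq_eq_integral (f : TrialSpace D) :
    ‖f‖ ^ 2 = ∫ z, f z * f z ∂(phaseMeasure D) := by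
  rw [← inner_eq_integral, real_inner_self_eq_norm_sq]

/-- Multiplication by a bounded function. -/
theorem exists_mulOperator {σ : Space d × Dir d → ℝ} (hσ : Measurable σ) {C : ℝ}
    (hC : ∀ᵐ z ∂(phaseMeasure D), |σ z| ≤ C) :
    ∃ S : TrialSpace D →L[ℝ] TrialSpace D,
      ∀ w : TrialSpace D, S w =ᵐ[phaseMeasure D] fun z => σ z * w z := by
  have hmem : ∀ w : TrialSpace D, MemLp (fun z => σ z * w z) 2 (phaseMeasure D) := by
    intro w
    refine (Lp.memLp w).of_le_mul (c := C)
      (hσ.aestronglyMeasurable.mul (Lp.aestronglyMeasurable w)) ?_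
    filter_upwards [hC] with z hz
    rw [norm_mul]
    exact mul_le_mul_of_nonneg_right hz (norm_nonneg _)
  let S₀ : TrialSpace D →ₗ[ℝ] TrialSpace D :=
    { toFun := fun w => (hmem w).toLp
      map_add' := fun v w => by
        refine Lp.ext ?_
        filter_upwards [(hmem (v + w)).coeFn_toLp, (hmem v).coeFn_toLp, (hmem w).coeFn_toLp,
          Lp.coeFn_add v w, Lp.coeFn_add (hmem v).toLp (hmem w).toLp] with z h1 h2 h3 h4 h5
        rw [h1, h5, Pi.add_apply, h2, h3, h4, Pi.add_apply, mul_add]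
      map_smul' := fun a w => by
        refine Lp.ext ?_
        filter_upwards [(hmem (a • w)).coeFn_toLp, (hmem w).coeFn_toLp,
          Lp.coeFn_smul a w, Lp.coeFn_smul a (hmem w).toLp] with z h1 h2 h3 h4
        rw [h1, RingHom.id_apply, h4, Pi.smul_apply, h2, h3, Pi.smul_apply, smul_eq_mul,
          smul_eq_mul]
        ring }
  refine ⟨S₀.mkContinuous C fun w => ?_, fun w => (hmem w).coeFn_toLp⟩
  refine Lp.norm_le_mul_norm_of_ae_le_mul ?_
  filter_upwards [(hmem w).coeFn_toLp, hC] with z h1 h2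
  change ‖MemLp.toLp _ (hmem w) z‖ ≤ _
  rw [h1, norm_mul]
  exact mul_le_mul_of_nonneg_right h2 (norm_nonneg _)

theorem ae_dir_ae_space {P : Space d × Dir d → Prop} (h : ∀ᵐ z ∂(phaseMeasure D), P z) :
    ∀ᵐ s ∂(dirMeasure d), ∀ᵐ x ∂(volume.restrict D), P (x, s) := by
  have h1 := (Measure.measurePreserving_swap (μ := dirMeasure d)
    (ν := volume.restrict D)).quasiMeasurePreserving.ae h
  exact Measure.ae_ae_of_ae_prod h1

/-- The weighted energy inequality on the lines in one direction. -/
theorem integral_weight_nonpos (ho : IsOpen D) (hb : Bornology.IsBounded D) (hc : Convex ℝ D)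
    {v : Space d × Space d → ℝ} (hv : ContDiff ℝ 1 v) (hv0 : ∀ z ∈ outflow D, v z = 0)
    {W : ℝ → ℝ} (hW : ContDiff ℝ 1 W) (hW0 : ∀ t ∈ Set.Icc 0 (Metric.diam D), 0 ≤ W t)
    (s : Dir d) {Φ : Space d → ℝ} (hΦ : Integrable Φ (volume.restrict D))
    (hle : ∀ᵐ x ∂(volume.restrict D), ∀ t ∈ Set.Icc 0 (Metric.diam D),
      Φ x ≤ deriv W t * v (x, s) ^ 2 + 2 * W t * (v (x, s) * streamDeriv v (x, s))) :
    ∫ x in D, Φ x ≤ 0 := by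
  have hs : ‖(s : Space d)‖ = 1 := mem_sphere_zero_iff_norm.1 s.2
  rcases D.eq_empty_or_nonempty with rfl | ⟨x₀, hx₀⟩
  · simp
  -- On `D` the coordinate `s · x - m` runs within `[0, diam D]`. The offset depends on `s`, but `Φ`
  -- is bounded for every `t`, so the measurability of this dependence is never an issue.
  set m := sInf ((fun x => inner ℝ (s : Space d) x) '' D) with hm
  have hbdd : BddBelow ((fun x => inner ℝ (s : Space d) x) '' D) := by
    obtain ⟨R, hR⟩ := hb.exists_norm_le
    refine ⟨-R, ?_⟩
    rintro _ ⟨x, hx, rfl⟩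
    have h1 := abs_real_inner_le_norm (s : Space d) x
    rw [hs, one_mul] at h1
    have := neg_le_of_abs_le (h1.trans (hR x hx))
    exact this
  have hτ : ∀ x ∈ D, inner ℝ (s : Space d) x - m ∈ Set.Icc 0 (Metric.diam D) := by
    intro x hx
    refine ⟨sub_nonneg.2 (csInf_le hbdd ⟨x, hx, rfl⟩), ?_⟩
    rw [sub_le_comm]
    refine le_csInf ⟨_, x₀, hx₀, rfl⟩ ?_
    rintro _ ⟨y, hy, rfl⟩
    have h1 := real_inner_le_norm (s : Space d) (x - y)
    rw [hs, one_mul, inner_sub_right, ← dist_eq_norm] at h1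
    have := Metric.dist_le_diam_of_mem hb hx hy
    simp only
    linarith
  let h : Space d → ℝ := fun x => W (inner ℝ (s : Space d) x - m) * v (x, s) ^ 2
  have hh : ContDiff ℝ 1 h := by
    refine (hW.comp ?_).mul ((hv.comp ?_).pow 2)
    · exact (contDiff_const.inner ℝ contDiff_id).sub contDiff_const
    · fun_prop
  have hderiv : ∀ x, fderiv ℝ h x s = deriv W (inner ℝ (s : Space d) x - m) * v (x, s) ^ 2
      + 2 * W (inner ℝ (s : Space d) x - m) * (v (x, s) * streamDeriv v (x, s)) := by
    intro x
    have h1 : HasFDerivAt (fun x => inner ℝ (s : Space d) x - m) (innerSL ℝ (s : Space d)) x :=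
      (innerSL ℝ (s : Space d)).hasFDerivAt.sub_const m
    have h2 := (hW.differentiable one_ne_zero (inner ℝ (s : Space d) x - m)).hasDerivAt
      |>.comp_hasFDerivAt x h1
    have h3 : HasFDerivAt (fun x => v (x, (s : Space d)))
        ((fderiv ℝ v (x, s)).comp (ContinuousLinearMap.inl ℝ (Space d) (Space d))) x :=
      (hv.differentiable one_ne_zero (x, (s : Space d))).hasFDerivAt.comp x
        (hasFDerivAt_prodMk_left x (s : Space d))
    have h4 : HasFDerivAt h _ x := h2.mul (h3.pow 2)
    rw [h4.fderiv]
    simp [streamDeriv, hs]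
    ring
  have key := integral_fderiv_nonpos ho hb hc hs hh
    (fun x hx => mul_nonneg (hW0 _ (hτ x hx)) (sq_nonneg _))
    (fun p hp => by simp [h, hv0 _ hp])
  refine le_trans (integral_mono_ae hΦ ?_ ?_) key
  · have hcont : Continuous fun x => fderiv ℝ h x s :=
      (hh.continuous_fderiv one_ne_zero).clm_apply continuous_const
    exact (hcont.continuousOn.integrableOn_compact
      (Metric.isCompact_of_isClosed_isBounded isClosed_closure hb.closure)).mono_set subset_closure
  · filter_upwards [hle, ae_restrict_mem ho.measurableSet] with x hx hxD
    rw [hderiv]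
    exact hx _ (hτ x hxD)

/-- The weighted energy inequality on phase space. -/
theorem integral_phase_weight_nonpos (ho : IsOpen D) (hb : Bornology.IsBounded D)
    (hc : Convex ℝ D) {p : WithLp 2 (TrialSpace D × TrialSpace D)} (hp : p ∈ smoothTestPairs D)
    {W : ℝ → ℝ} (hW : ContDiff ℝ 1 W) (hW0 : ∀ t ∈ Set.Icc 0 (Metric.diam D), 0 ≤ W t)
    {Φ : Space d × Dir d → ℝ} (hΦ : Integrable Φ (phaseMeasure D))
    (hle : ∀ᵐ z ∂(phaseMeasure D), ∀ t ∈ Set.Icc 0 (Metric.diam D),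
      Φ z ≤ deriv W t * p.fst z ^ 2 + 2 * W t * (p.fst z * p.snd z)) :
    ∫ z, Φ z ∂(phaseMeasure D) ≤ 0 := by
  obtain ⟨v, hv, hv0, h1, h2⟩ := hp
  unfold phaseMeasure at hΦ ⊢
  rw [integral_prod_symm _ hΦ]
  refine integral_nonpos_of_ae ?_
  have hle' : ∀ᵐ z ∂(phaseMeasure D), ∀ t ∈ Set.Icc 0 (Metric.diam D),
      Φ z ≤ deriv W t * v (z.1, z.2) ^ 2
        + 2 * W t * (v (z.1, z.2) * streamDeriv v (z.1, z.2)) := by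
    filter_upwards [hle, h1, h2] with z hz hz1 hz2
    simpa only [hz1, hz2] using hz
  filter_upwards [ae_dir_ae_space hle', hΦ.prod_left_ae] with s hs hint
  exact integral_weight_nonpos ho hb hc hv hv0 hW hW0 s hint hs

theorem closure_induction_testSpace {P : WithLp 2 (TrialSpace D × TrialSpace D) → Prop}
    (hclosed : IsClosed {p | P p}) (h : ∀ p ∈ smoothTestPairs D, P p) (v : TestSpace D) : P v := by
  have hv : (v : WithLp 2 (TrialSpace D × TrialSpace D)) ∈
      closure (smoothTestPairs D : Set (WithLp 2 (TrialSpace D × TrialSpace D))) := v.2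
  have hsub : (smoothTestPairs D : Set (WithLp 2 (TrialSpace D × TrialSpace D))) ⊆ {p | P p} :=
    fun p hp => h p hp
  exact closure_minimal hsub hclosed hv

/-- This is the weight `1`: `2 v (s · ∇v)` is the derivative of `v²` along `s`. -/
theorem inner_sd_fn_nonpos (ho : IsOpen D) (hb : Bornology.IsBounded D) (hc : Convex ℝ D)
    (v : TestSpace D) : inner ℝ v.sd v.fn ≤ 0 := by
  refine closure_induction_testSpace (P := fun p => inner ℝ p.snd p.fst ≤ 0) ?_ ?_ v
  · exact isClosed_le (by fun_prop) continuous_const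
  · intro p hp
    have := integral_phase_weight_nonpos ho hb hc hp (W := fun _ => 1) contDiff_const
      (fun _ _ => zero_le_one) ((integrable_mul p.snd p.fst).const_mul 2)
      (Eventually.of_forall fun z t _ => by
        simp only [deriv_const, zero_mul, zero_add]; linarith)
    rw [integral_const_mul, ← inner_eq_integral] at this
    linarith

/-- A pointwise inequality between a weight and the absorption yields an `L₂` bound. -/
theorem norm_fn_le_of_weight (ho : IsOpen D) (hb : Bornology.IsBounded D) (hc : Convex ℝ D)
    {σ : Space d × Dir d → ℝ} {S : TrialSpace D →L[ℝ] TrialSpace D}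
    (hS : ∀ w : TrialSpace D, S w =ᵐ[phaseMeasure D] fun z => σ z * w z) {m C : ℝ}
    (hm : ∀ᵐ z ∂(phaseMeasure D), m ≤ σ z)
    {W : ℝ → ℝ} (hW : ContDiff ℝ 1 W) (hW0 : ∀ t ∈ Set.Icc 0 (Metric.diam D), 0 ≤ W t)
    (hpt : ∀ t ∈ Set.Icc 0 (Metric.diam D), ∀ r, m ≤ r → ∀ x y,
      x ^ 2 - C * (r * x - y) ^ 2 ≤ deriv W t * x ^ 2 + 2 * W t * (x * y))
    (v : TestSpace D) : ‖v.fn‖ ^ 2 ≤ C * ‖S v.fn - v.sd‖ ^ 2 := by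
  refine closure_induction_testSpace (P := fun p => ‖p.fst‖ ^ 2 ≤ C * ‖S p.fst - p.snd‖ ^ 2)
    ?_ ?_ v
  · exact isClosed_le (by fun_prop) (by fun_prop)
  · intro p hp
    have := integral_phase_weight_nonpos ho hb hc hp hW hW0
      ((integrable_mul p.fst p.fst).sub
        ((integrable_mul (S p.fst - p.snd) (S p.fst - p.snd)).const_mul C)) (by
      filter_upwards [hS p.fst, hm, Lp.coeFn_sub (S p.fst) p.snd] with z h1 h2 h3 t ht
      have h4 := hpt t ht (σ z) h2 (p.fst z) (p.snd z)
      simp only [Pi.sub_apply, h3, h1]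
      linarith)
    have h5 : ∫ z, ((fun z => p.fst z * p.fst z) - fun z =>
        C * ((S p.fst - p.snd : TrialSpace D) z * (S p.fst - p.snd : TrialSpace D) z)) z
        ∂(phaseMeasure D) = ‖p.fst‖ ^ 2 - C * ‖S p.fst - p.snd‖ ^ 2 := by
      simp only [Pi.sub_apply]
      rw [integral_sub (integrable_mul _ _) ((integrable_mul _ _).const_mul C), integral_const_mul,
        ← norm_sq_eq_integral, ← norm_sq_eq_integral]
    rw [h5] at this
    linarith

/-- For the weight `W t = t`, put `g = r x - y`. Since `t ≤ diam D`, the pointwise inequality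
reduces to `t ((g - 2 m x)² + 4 m (r - m) x²) ≥ 0`. -/
theorem norm_fn_sq_le_of_pos (ho : IsOpen D) (hb : Bornology.IsBounded D) (hc : Convex ℝ D)
    {σ : Space d × Dir d → ℝ} {S : TrialSpace D →L[ℝ] TrialSpace D}
    (hS : ∀ w : TrialSpace D, S w =ᵐ[phaseMeasure D] fun z => σ z * w z) {m : ℝ} (hm0 : 0 < m)
    (hm : ∀ᵐ z ∂(phaseMeasure D), m ≤ σ z) (v : TestSpace D) :
    ‖v.fn‖ ^ 2 ≤ Metric.diam D / (2 * m) * ‖S v.fn - v.sd‖ ^ 2 := by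
  refine norm_fn_le_of_weight ho hb hc hS hm (W := fun t => t) contDiff_id (fun t ht => ht.1) ?_ v
  intro t ht r hr x y
  have hd : deriv (fun t : ℝ => t) t = 1 := deriv_id t
  rw [hd, div_mul_eq_mul_div, sub_le_iff_le_add, ← sub_le_iff_le_add', le_div_iff₀ (by positivity)]
  have h1 : t * (r * x - y) ^ 2 ≤ Metric.diam D * (r * x - y) ^ 2 :=
    mul_le_mul_of_nonneg_right ht.2 (sq_nonneg _)
  have h2 : 0 ≤ t * ((r * x - y) - 2 * m * x) ^ 2 := mul_nonneg ht.1 (sq_nonneg _)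
  have h3 : 0 ≤ t * m * (r - m) * x ^ 2 :=
    mul_nonneg (mul_nonneg (mul_nonneg ht.1 hm0.le) (sub_nonneg.2 hr)) (sq_nonneg _)
  nlinarith

/-- For a weight `l q(t / l)` with `q ≥ 0`, completing the square leaves the Riccati inequality `q'
≥ 1 + q²` on `[0, 1]`. The function `tan` gives equality; the polynomial `a + a³/2 + a⁵/2` is a
supersolution that needs only algebra. -/
theorem norm_fn_le_diam_mul (ho : IsOpen D) (hb : Bornology.IsBounded D) (hc : Convex ℝ D)
    (hdiam : 0 < Metric.diam D)
    {σ : Space d × Dir d → ℝ} {S : TrialSpace D →L[ℝ] TrialSpace D}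
    (hS : ∀ w : TrialSpace D, S w =ᵐ[phaseMeasure D] fun z => σ z * w z)
    (hm : ∀ᵐ z ∂(phaseMeasure D), 0 ≤ σ z) (v : TestSpace D) :
    ‖v.fn‖ ≤ Metric.diam D * ‖S v.fn - v.sd‖ := by
  set l := Metric.diam D with hl
  suffices h : ‖v.fn‖ ^ 2 ≤ l ^ 2 * ‖S v.fn - v.sd‖ ^ 2 by
    rw [← mul_pow] at h
    exact le_of_sq_le_sq h (by positivity)
  refine norm_fn_le_of_weight ho hb hc hS hm
    (W := fun t => l * (t / l + (t / l) ^ 3 / 2 + (t / l) ^ 5 / 2)) (by fun_prop) (fun t ht => ?_)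
    ?_ v
  · have := ht.1
    positivity
  intro t ht r hr x y
  set a := t / l with ha
  have ha0 : 0 ≤ a := div_nonneg ht.1 hdiam.le
  have ha1 : a ≤ 1 := (div_le_one hdiam).2 ht.2
  have hd : deriv (fun t => l * (t / l + (t / l) ^ 3 / 2 + (t / l) ^ 5 / 2)) t
      = 1 + 3 / 2 * a ^ 2 + 5 / 2 * a ^ 4 := by
    have h1 : HasDerivAt (fun t : ℝ => t / l) (1 / l) t := (hasDerivAt_id t).div_const l
    have h2 := (((h1.add ((h1.pow 3).div_const 2)).add ((h1.pow 5).div_const 2)).const_mul l).deriv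
    refine Eq.trans h2 ?_
    simp only [← ha]
    field_simp
    push_cast
    ring
  rw [hd]
  set q := a + a ^ 3 / 2 + a ^ 5 / 2 with hq
  have hq0 : 0 ≤ q := by positivity
  have hricc : 1 + q ^ 2 ≤ 1 + 3 / 2 * a ^ 2 + 5 / 2 * a ^ 4 := by
    have hb0 : 0 ≤ a ^ 2 := sq_nonneg a
    have hb1 : a ^ 2 ≤ 1 := by nlinarith
    -- The factor `a²` common to `q²` and `q' - 1` is removed. At `a = 1` there is equality.
    have h1 : (1 + a ^ 2 / 2 + (a ^ 2) ^ 2 / 2) ^ 2 ≤ 3 / 2 + 5 / 2 * a ^ 2 := by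
      generalize a ^ 2 = b at hb0 hb1
      have h2 : 0 ≤ b * (1 - b) := mul_nonneg hb0 (by linarith)
      have h3 : b ^ 2 ≤ b := by nlinarith
      have h4 : b ^ 3 ≤ b := by nlinarith
      have h5 : b ^ 4 ≤ b := by nlinarith
      nlinarith
    have h2 := mul_le_mul_of_nonneg_left h1 hb0
    rw [hq]
    nlinarith
  have h1 : 0 ≤ (l * (r * x - y) - q * x) ^ 2 := sq_nonneg _
  have h2 := mul_le_mul_of_nonneg_right hricc (sq_nonneg x)
  have h3 : 0 ≤ l * q * r * x ^ 2 := by positivity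
  nlinarith

end Energy

/-! ### Smooth solutions for a dense set of sources -/

section Density

open Filter Topology

/-- Differentiation under the integral sign for `C¹` integrands. -/
theorem hasFDerivAt_parametric_intervalIntegral {H : Type*} [NormedAddCommGroup H]
    [NormedSpace ℝ H] [FiniteDimensional ℝ H] {F : H × ℝ → ℝ} (hF : ContDiff ℝ 1 F) (a b : ℝ)
    (x : H) :
    HasFDerivAt (fun x => ∫ t in a..b, F (x, t))
      (∫ t in a..b, (fderiv ℝ F (x, t)).comp (ContinuousLinearMap.inl ℝ H ℝ)) x := by
  have : ProperSpace H := FiniteDimensional.proper ℝ H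
  have hcont : Continuous fun p : H × ℝ =>
      (fderiv ℝ F p).comp (ContinuousLinearMap.inl ℝ H ℝ) :=
    (hF.continuous_fderiv one_ne_zero).clm_comp continuous_const
  obtain ⟨C, hC⟩ := ((isCompact_closedBall x 1).prod
    (isCompact_uIcc (a := a) (b := b))).exists_bound_of_continuousOn hcont.continuousOn
  refine intervalIntegral.hasFDerivAt_integral_of_dominated_of_fderiv_le
    (F := fun x t => F (x, t))
    (F' := fun x t => (fderiv ℝ F (x, t)).comp (ContinuousLinearMap.inl ℝ H ℝ))
    (bound := fun _ => C) (Metric.ball_mem_nhds x one_pos) ?_ ?_ ?_ ?_ ?_ ?_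
  · exact Eventually.of_forall fun y =>
      (hF.continuous.comp (by fun_prop)).aestronglyMeasurable
  · exact (hF.continuous.comp (by fun_prop : Continuous fun t : ℝ => (x, t))).intervalIntegrable _ _
  · exact (hcont.comp (by fun_prop : Continuous fun t : ℝ => (x, t))).aestronglyMeasurable
  · refine Eventually.of_forall fun t ht y hy => hC (y, t) ⟨Metric.ball_subset_closedBall hy, ?_⟩
    exact Set.uIoc_subset_uIcc ht
  · exact intervalIntegrable_const
  · refine Eventually.of_forall fun t _ y _ => ?_
    exact (hF.differentiable one_ne_zero (y, t)).hasFDerivAt.comp y (hasFDerivAt_prodMk_left y t)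

theorem contDiff_parametric_intervalIntegral {H : Type*} [NormedAddCommGroup H]
    [NormedSpace ℝ H] [FiniteDimensional ℝ H] {F : H × ℝ → ℝ} (hF : ContDiff ℝ 1 F) (a b : ℝ) :
    ContDiff ℝ 1 fun x => ∫ t in a..b, F (x, t) := by
  refine contDiff_one_iff_hasFDerivAt.2
    ⟨_, ?_, fun x => hasFDerivAt_parametric_intervalIntegral hF a b x⟩
  refine intervalIntegral.continuous_parametric_intervalIntegral_of_continuous' ?_ a b
  exact (hF.continuous_fderiv one_ne_zero).clm_comp continuous_const

variable {d : ℕ} {D : Set (Space d)}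

/-- The integrand of the solution formula for `l v - s · ∇v = g`. -/
def rayIntegrand (l : ℝ) (g : Space d × Space d → ℝ) (p : (Space d × Space d) × ℝ) : ℝ :=
  Real.exp (-(l * p.2)) * g (p.1.1 + p.2 • p.1.2, p.1.2)

/-- The solution formula for `l v - s · ∇v = g`. -/
def raySolution (l T : ℝ) (g : Space d × Space d → ℝ) (z : Space d × Space d) : ℝ :=
  ∫ t in (0 : ℝ)..T, rayIntegrand l g (z, t)

theorem contDiff_rayIntegrand (l : ℝ) {g : Space d × Space d → ℝ} (hg : ContDiff ℝ 1 g) :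
    ContDiff ℝ 1 (rayIntegrand l g) := by
  unfold rayIntegrand
  refine ContDiff.mul ?_ (hg.comp ?_)
  · exact (contDiff_const.mul contDiff_snd).neg.exp
  · fun_prop

theorem contDiff_raySolution (l T : ℝ) {g : Space d × Space d → ℝ} (hg : ContDiff ℝ 1 g) :
    ContDiff ℝ 1 (raySolution l T g) :=
  contDiff_parametric_intervalIntegral (contDiff_rayIntegrand l hg) 0 T

/-- The integrand satisfies `dF/dt = -l F + ∂F` with `∂` the derivative in direction `(s, 0)`,
because shifting `x` by `s` and increasing `t` move the argument of `g` alike. Integrate from `0` to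
`T`. A fixed `T` in place of the exit time keeps the solution `C¹`. -/
theorem streamDeriv_raySolution (l T : ℝ) {g : Space d × Space d → ℝ} (hg : ContDiff ℝ 1 g)
    (x : Space d) (s : Dir d) (hT : g (x + T • (s : Space d), s) = 0) :
    l * raySolution l T g (x, s) - streamDeriv (raySolution l T g) (x, s) = g (x, s) := by
  have hF := contDiff_rayIntegrand l hg
  have hcont : Continuous fun t : ℝ =>
      (fderiv ℝ (rayIntegrand l g) ((x, (s : Space d)), t)).comp
        (ContinuousLinearMap.inl ℝ (Space d × Space d) ℝ) :=
    ((hF.continuous_fderiv one_ne_zero).comp (by fun_prop)).clm_comp continuous_const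
  have hsd : streamDeriv (raySolution l T g) (x, s) = ∫ t in (0 : ℝ)..T,
      fderiv ℝ (rayIntegrand l g) ((x, (s : Space d)), t) ((s, 0), 0) := by
    unfold streamDeriv raySolution
    rw [(hasFDerivAt_parametric_intervalIntegral hF 0 T (x, (s : Space d))).fderiv,
      ContinuousLinearMap.intervalIntegral_apply (hcont.intervalIntegrable 0 T)]
    rfl
  have hline : ∀ t : ℝ, HasDerivAt (fun t => rayIntegrand l g ((x, (s : Space d)), t))
      (-(l * rayIntegrand l g ((x, (s : Space d)), t))
        + fderiv ℝ (rayIntegrand l g) ((x, (s : Space d)), t) ((s, 0), 0)) t := by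
    intro t
    have hgt := (hg.differentiable one_ne_zero (x + t • (s : Space d), (s : Space d))).hasFDerivAt
    have h1 : HasDerivAt (fun t : ℝ => (x + t • (s : Space d), (s : Space d)))
        ((s : Space d), 0) t := by
      refine HasDerivAt.prodMk ?_ (hasDerivAt_const _ _)
      simpa using ((hasDerivAt_id t).smul_const (s : Space d)).const_add x
    have h2 := hgt.comp_hasDerivAt t h1
    have h3 : HasDerivAt (fun t : ℝ => Real.exp (-(l * t))) (Real.exp (-(l * t)) * (-l)) t := by
      have : HasDerivAt (fun t : ℝ => -(l * t)) (-l) t := by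
        simpa using ((hasDerivAt_id t).const_mul l).fun_neg
      exact this.exp
    have h4 : fderiv ℝ (rayIntegrand l g) ((x, (s : Space d)), t) ((s, 0), 0)
        = Real.exp (-(l * t)) * fderiv ℝ g (x + t • (s : Space d), s) ((s : Space d), 0) := by
      have h5 : HasDerivAt (fun r : ℝ => ((x + r • (s : Space d), (s : Space d)), t))
          (((s : Space d), 0), 0) 0 := by
        refine HasDerivAt.prodMk (HasDerivAt.prodMk ?_ (hasDerivAt_const _ _))
          (hasDerivAt_const _ _)
        simpa using ((hasDerivAt_id (0 : ℝ)).smul_const (s : Space d)).const_add x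
      have h6 := HasFDerivAt.comp_hasDerivAt_of_eq (0 : ℝ)
        (hF.differentiable one_ne_zero ((x, (s : Space d)), t)).hasFDerivAt h5 (by simp)
      have h7 : HasDerivAt (fun r : ℝ => (x + r • (s : Space d) + t • (s : Space d),
          (s : Space d))) ((s : Space d), 0) 0 := by
        refine HasDerivAt.prodMk ?_ (hasDerivAt_const _ _)
        simpa using (((hasDerivAt_id (0 : ℝ)).smul_const (s : Space d)).const_add x).add_const
          (t • (s : Space d))
      have h8 := (HasFDerivAt.comp_hasDerivAt_of_eq (0 : ℝ) hgt h7 (by simp)).const_mul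
        (Real.exp (-(l * t)))
      exact h6.unique h8
    have h9 := h3.mul h2
    rw [h4]
    refine h9.congr_deriv ?_
    simp only [rayIntegrand, Function.comp_apply]
    ring
  have hc1 : Continuous fun t : ℝ => rayIntegrand l g ((x, (s : Space d)), t) :=
    hF.continuous.comp (by fun_prop)
  have hc2 : Continuous fun t : ℝ =>
      fderiv ℝ (rayIntegrand l g) ((x, (s : Space d)), t) ((s, 0), 0) :=
    ((hF.continuous_fderiv one_ne_zero).comp (by fun_prop)).clm_apply continuous_const
  have hc1l : Continuous fun t : ℝ => -(l * rayIntegrand l g ((x, (s : Space d)), t)) :=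
    (continuous_const.mul hc1).neg
  have hftc := intervalIntegral.integral_eq_sub_of_hasDerivAt (a := 0) (b := T)
    (fun t _ => hline t) ((hc1l.add hc2).intervalIntegrable 0 T)
  rw [intervalIntegral.integral_add (hc1l.intervalIntegrable 0 T)
    (hc2.intervalIntegrable 0 T), intervalIntegral.integral_neg,
    intervalIntegral.integral_const_mul, ← hsd] at hftc
  have h0 : rayIntegrand l g ((x, (s : Space d)), 0) = g (x, s) := by simp [rayIntegrand]
  have h1 : rayIntegrand l g ((x, (s : Space d)), T) = 0 := by simp [rayIntegrand, hT]
  rw [h0, h1] at hftc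
  unfold raySolution at hftc ⊢
  linarith

/-- From an outflow point the ray runs strictly beyond a supporting hyperplane of `D`, where the
source vanishes. -/
theorem raySolution_eq_zero_of_mem_outflow (l : ℝ) {T : ℝ} (hT : 0 ≤ T)
    {g : Space d × Space d → ℝ} (hg : ∀ z, z.1 ∉ D → g z = 0)
    {z : Space d × Space d} (hz : z ∈ outflow D) : raySolution l T g z = 0 := by
  obtain ⟨hfr, -, n, hn, -, hpos⟩ := hz
  refine intervalIntegral.integral_zero_ae (Eventually.of_forall fun t ht => ?_)
  rw [Set.uIoc_of_le hT] at ht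
  have hnot : z.1 + t • z.2 ∉ D := by
    intro hmem
    have := hn.2 _ hmem
    rw [add_sub_cancel_left, real_inner_smul_right, real_inner_comm] at this
    nlinarith [ht.1]
  simp [rayIntegrand, hg (z.1 + t • z.2, z.2) hnot]

theorem isFiniteMeasure_phaseMeasure (hb : Bornology.IsBounded D) :
    IsFiniteMeasure (phaseMeasure D) := by
  have : IsFiniteMeasure (volume.restrict D) := isFiniteMeasure_restrict.2 hb.measure_lt_top.ne
  unfold phaseMeasure
  infer_instance

theorem ae_fst_mem (ho : IsOpen D) : ∀ᵐ z ∂(phaseMeasure D), z.1 ∈ D :=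
  Measure.quasiMeasurePreserving_fst.ae (ae_restrict_mem ho.measurableSet)

theorem continuous_incl : Continuous fun z : Space d × Dir d => (z.1, (z.2 : Space d)) := by
  fun_prop

theorem memLp_incl (ho : IsOpen D) (hb : Bornology.IsBounded D) {v : Space d × Space d → ℝ}
    (hv : Continuous v) : MemLp (fun z : Space d × Dir d => v (z.1, (z.2 : Space d))) 2
      (phaseMeasure D) := by
  have := isFiniteMeasure_phaseMeasure hb
  obtain ⟨C, hC⟩ := ((Metric.isCompact_of_isClosed_isBounded isClosed_closure hb.closure).prod
    (isCompact_sphere (0 : Space d) 1)).exists_bound_of_continuousOn hv.continuousOn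
  refine MemLp.of_bound (hv.comp continuous_incl).aestronglyMeasurable C ?_
  filter_upwards [ae_fst_mem ho] with z hz
  exact hC (z.1, z.2) ⟨subset_closure hz, z.2.2⟩

theorem continuous_streamDeriv_ambient {v : Space d × Space d → ℝ} (hv : ContDiff ℝ 1 v) :
    Continuous fun z : Space d × Space d => fderiv ℝ v z (z.2, 0) :=
  (hv.continuous_fderiv one_ne_zero).clm_apply (by fun_prop)

/-- A `C¹` function that vanishes on the outflow boundary defines a test function. -/
theorem exists_testSpace (ho : IsOpen D) (hb : Bornology.IsBounded D)
    {v : Space d × Space d → ℝ} (hv : ContDiff ℝ 1 v) (hv0 : ∀ z ∈ outflow D, v z = 0) :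
    ∃ p : TestSpace D, (p.fn =ᵐ[phaseMeasure D] fun z => v (z.1, (z.2 : Space d))) ∧
      (p.sd =ᵐ[phaseMeasure D] streamDeriv v) := by
  have h1 := memLp_incl (D := D) ho hb hv.continuous
  have h2 : MemLp (streamDeriv v) 2 (phaseMeasure D) :=
    memLp_incl ho hb (continuous_streamDeriv_ambient hv)
  have hmem : WithLp.toLp 2 (h1.toLp _, h2.toLp _) ∈ smoothTestPairs D :=
    ⟨v, hv, hv0, h1.coeFn_toLp, h2.coeFn_toLp⟩
  exact ⟨⟨_, Submodule.le_topologicalClosure _ hmem⟩, h1.coeFn_toLp, h2.coeFn_toLp⟩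

/-- Write `g = l v - s · ∇v` with `v` the ray solution, which is an admissible test function. The
length `T = diam D + 1` carries every point of `D` out of `D`. -/
theorem integral_mul_eq_zero_of_orthogonal (ho : IsOpen D) (hb : Bornology.IsBounded D) (l : ℝ)
    {w : TrialSpace D} (hw : ∀ v : TestSpace D, inner ℝ w (l • v.fn - v.sd) = 0)
    {g : Space d × Space d → ℝ} (hg : ContDiff ℝ 1 g) (hg0 : ∀ z, z.1 ∉ D → g z = 0) :
    ∫ z, w z * g (z.1, (z.2 : Space d)) ∂(phaseMeasure D) = 0 := by
  have hT0 : 0 ≤ Metric.diam D + 1 := by linarith [Metric.diam_nonneg (s := D)]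
  obtain ⟨p, hp1, hp2⟩ := exists_testSpace ho hb (contDiff_raySolution l (Metric.diam D + 1) hg)
    (fun z hz => raySolution_eq_zero_of_mem_outflow l hT0 hg0 hz)
  rw [← hw p, inner_eq_integral]
  refine integral_congr_ae ?_
  filter_upwards [hp1, hp2, Lp.coeFn_sub (l • p.fn) p.sd, Lp.coeFn_smul l p.fn, ae_fst_mem ho]
    with z h1 h2 h3 h4 hz
  rw [h3, Pi.sub_apply, h4, Pi.smul_apply, h1, h2, smul_eq_mul]
  have hs : ‖(z.2 : Space d)‖ = 1 := mem_sphere_zero_iff_norm.1 z.2.2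
  have hnot : z.1 + (Metric.diam D + 1) • (z.2 : Space d) ∉ D := by
    intro hmem
    have := Metric.dist_le_diam_of_mem hb hmem hz
    rw [dist_eq_norm, add_sub_cancel_left, norm_smul, hs, mul_one, Real.norm_of_nonneg hT0] at this
    linarith
  rw [← streamDeriv_raySolution l (Metric.diam D + 1) hg z.1 z.2 (hg0 _ hnot)]

theorem measurableEmbedding_incl :
    MeasurableEmbedding fun z : Space d × Dir d => (z.1, (z.2 : Space d)) :=
  MeasurableEmbedding.id.prodMap (MeasurableEmbedding.subtype_coe
    (Metric.isClosed_sphere (x := (0 : Space d)) (ε := 1)).measurableSet)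

/-- The measure is pushed forward along the embedding of the sphere and `w` is extended by zero, so
that the fundamental lemma of the calculus of variations applies on the open set `D × ℝᵈ`. -/
theorem eq_zero_of_integral_mul_eq_zero (ho : IsOpen D) (hb : Bornology.IsBounded D)
    {w : TrialSpace D} (hw : ∀ g : Space d × Space d → ℝ, ContDiff ℝ 1 g →
      (∀ z, z.1 ∉ D → g z = 0) → ∫ z, w z * g (z.1, (z.2 : Space d)) ∂(phaseMeasure D) = 0) :
    w = 0 := by
  have := isFiniteMeasure_phaseMeasure hb
  have hι := measurableEmbedding_incl (d := d)
  set f : Space d × Space d → ℝ :=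
    Function.extend (fun z : Space d × Dir d => (z.1, (z.2 : Space d))) w 0 with hf
  have hfι : ∀ z : Space d × Dir d, f (z.1, (z.2 : Space d)) = w z := fun z =>
    hι.injective.extend_apply w 0 z
  have hint : Integrable f ((phaseMeasure D).map fun z => (z.1, (z.2 : Space d))) := by
    rw [hι.integrable_map_iff]
    refine ((Lp.memLp w).integrable one_le_two).congr (Eventually.of_forall fun z => ?_)
    exact (hfι z).symm
  have key := (ho.prod isOpen_univ).ae_eq_zero_of_integral_contDiff_smul_eq_zero
    (μ := (phaseMeasure D).map fun z => (z.1, (z.2 : Space d)))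
    (U := D ×ˢ (Set.univ : Set (Space d))) (hint.locallyIntegrable.locallyIntegrableOn _) ?_
  · rw [hι.ae_map_iff] at key
    refine Lp.ext ?_
    filter_upwards [key, ae_fst_mem ho, Lp.coeFn_zero ℝ 2 (phaseMeasure D)] with z hz hzD h0
    rw [h0, ← hfι, hz ⟨hzD, trivial⟩]
    rfl
  · intro g hg _ hsupp
    rw [hι.integral_map, ← hw g (hg.of_le (by simp))]
    · refine integral_congr_ae (Eventually.of_forall fun z => ?_)
      simp only [hfι, smul_eq_mul, mul_comm]
    · intro z hz
      by_contra hne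
      exact hz (hsupp (subset_tsupport g hne)).1

/-- The operators `l - s · ∇` have dense range. -/
theorem eq_zero_of_orthogonal (ho : IsOpen D) (hb : Bornology.IsBounded D) (l : ℝ)
    {w : TrialSpace D} (hw : ∀ v : TestSpace D, inner ℝ w (l • v.fn - v.sd) = 0) : w = 0 :=
  eq_zero_of_integral_mul_eq_zero ho hb fun _ hg hg0 =>
    integral_mul_eq_zero_of_orthogonal ho hb l hw hg hg0

end Density

/-! ### The scattering operator -/

section Scattering

open Filter Topology

variable {d : ℕ} {D : Set (Space d)}

instance : SFinite (phaseMeasure D) := by unfold phaseMeasure; infer_instance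

/-- Exchange of the two directions. -/
def swapDirs (p : (Space d × Dir d) × Dir d) : (Space d × Dir d) × Dir d := ((p.1.1, p.2), p.1.2)

theorem measurePreserving_swapDirs :
    MeasurePreserving (swapDirs (d := d)) ((phaseMeasure D).prod (dirMeasure d))
      ((phaseMeasure D).prod (dirMeasure d)) := by
  have h1 := measurePreserving_prodAssoc (volume.restrict D) (dirMeasure d) (dirMeasure d)
  have h2 := (MeasurePreserving.id (volume.restrict D)).prod
    (Measure.measurePreserving_swap (μ := dirMeasure d) (ν := dirMeasure d))
  exact (h1.symm.comp h2).comp h1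

/-- Nonnegative kernels with integrable rows. -/
structure IsScatterKernel (D : Set (Space d)) (k : Space d → Dir d → Dir d → ℝ) : Prop where
  measurable : Measurable fun p : (Space d × Dir d) × Dir d => k p.1.1 p.1.2 p.2
  nonneg : ∀ᵐ z ∂(phaseMeasure D), ∀ s, 0 ≤ k z.1 z.2 s
  integrable : ∀ᵐ z ∂(phaseMeasure D), Integrable (k z.1 z.2) (dirMeasure d)

/-- The row sums of a kernel. -/
def rowSum (k : Space d → Dir d → Dir d → ℝ) (z : Space d × Dir d) : ℝ :=
  ∫ s, k z.1 z.2 s ∂(dirMeasure d)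

/-- Fubini on `S × S` gives integrable rows for almost every `x` and then almost every `s`.
Measurability of the set of integrable rows turns this into a statement for the product measure. -/
theorem isScatterKernel_of_sq (ho : IsOpen D) {k : Space d → Dir d → Dir d → ℝ}
    (hk : Measurable fun p : Space d × Dir d × Dir d => k p.1 p.2.1 p.2.2)
    (hpos : ∀ x ∈ D, ∀ s s', 0 ≤ k x s s')
    (hsq : ∀ᵐ x ∂(volume.restrict D), Integrable (fun p : Dir d × Dir d => k x p.1 p.2)
      ((dirMeasure d).prod (dirMeasure d))) : IsScatterKernel D k := by
  have hm : Measurable fun p : (Space d × Dir d) × Dir d => k p.1.1 p.1.2 p.2 :=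
    hk.comp (by fun_prop : Measurable fun p : (Space d × Dir d) × Dir d => (p.1.1, p.1.2, p.2))
  refine ⟨hm, ?_, ?_⟩
  · filter_upwards [ae_fst_mem ho] with z hz s using hpos _ hz _ _
  · have hset : MeasurableSet {z : Space d × Dir d | Integrable (k z.1 z.2) (dirMeasure d)} :=
      measurableSet_integrable (f := fun (z : Space d × Dir d) s => k z.1 z.2 s) hm.stronglyMeasurable
    refine (Measure.ae_prod_iff_ae_ae hset).2 ?_
    filter_upwards [hsq] with x hx
    exact hx.prod_right_ae

theorem IsScatterKernel.rowSum_nonneg {k : Space d → Dir d → Dir d → ℝ}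
    (hk : IsScatterKernel D k) : ∀ᵐ z ∂(phaseMeasure D), 0 ≤ rowSum k z := by
  filter_upwards [hk.nonneg] with z hz
  exact integral_nonneg hz

/-- Integration of `k v²` over the second direction. -/
theorem IsScatterKernel.integrable_mul_sq {k : Space d → Dir d → Dir d → ℝ}
    (hk : IsScatterKernel D k) {C : ℝ} (hC : ∀ᵐ z ∂(phaseMeasure D), rowSum k z ≤ C)
    (v : TrialSpace D) :
    Integrable (fun z => rowSum k z * v z ^ 2) (phaseMeasure D) ∧
    Integrable (fun p : (Space d × Dir d) × Dir d => k p.1.1 p.1.2 p.2 * v p.1 ^ 2)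
      ((phaseMeasure D).prod (dirMeasure d)) ∧
    ∫ p : (Space d × Dir d) × Dir d, k p.1.1 p.1.2 p.2 * v p.1 ^ 2
      ∂((phaseMeasure D).prod (dirMeasure d)) = ∫ z, rowSum k z * v z ^ 2 ∂(phaseMeasure D) := by
  have hvm : Measurable v := (Lp.stronglyMeasurable v).measurable
  have hrow : StronglyMeasurable (rowSum k) := hk.measurable.stronglyMeasurable.integral_prod_right
  have h1 : Integrable (fun z => rowSum k z * v z ^ 2) (phaseMeasure D) := by
    refine Integrable.mono' ((integrable_mul v v).const_mul C)
      (hrow.measurable.mul (hvm.pow_const 2)).aestronglyMeasurable ?_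
    filter_upwards [hC, hk.rowSum_nonneg] with z h2 h3
    rw [Real.norm_of_nonneg (mul_nonneg h3 (sq_nonneg _)), ← sq]
    exact mul_le_mul_of_nonneg_right h2 (sq_nonneg _)
  have h2 : Integrable (fun p : (Space d × Dir d) × Dir d => k p.1.1 p.1.2 p.2 * v p.1 ^ 2)
      ((phaseMeasure D).prod (dirMeasure d)) := by
    have hmeas : Measurable fun p : (Space d × Dir d) × Dir d => k p.1.1 p.1.2 p.2 * v p.1 ^ 2 :=
      hk.measurable.mul ((hvm.comp measurable_fst).pow_const 2)
    rw [integrable_prod_iff hmeas.aestronglyMeasurable]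
    constructor
    · filter_upwards [hk.integrable] with z hz
      exact hz.mul_const _
    · refine h1.congr ?_
      filter_upwards [hk.nonneg] with z hz
      have : ∀ s, ‖k z.1 z.2 s * v z ^ 2‖ = k z.1 z.2 s * v z ^ 2 := fun s =>
        Real.norm_of_nonneg (mul_nonneg (hz s) (sq_nonneg _))
      simp only [this]
      rw [integral_mul_const, rowSum]
  refine ⟨h1, h2, ?_⟩
  rw [integral_prod _ h2]
  simp only [integral_mul_const, rowSum]

/-- A kernel with bounded row and column sums. -/
structure IsSchurKernel (D : Set (Space d)) (k : Space d → Dir d → Dir d → ℝ) : Prop where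
  row : IsScatterKernel D k
  col : IsScatterKernel D fun x s s' => k x s' s
  bdd_row : ∃ C, ∀ᵐ z ∂(phaseMeasure D), rowSum k z ≤ C
  bdd_col : ∃ C, ∀ᵐ z ∂(phaseMeasure D), rowSum (fun x s s' => k x s' s) z ≤ C

/-- The bilinear form of a kernel. -/
def kernelForm (D : Set (Space d)) (k : Space d → Dir d → Dir d → ℝ) (w v : TrialSpace D) : ℝ :=
  ∫ p : (Space d × Dir d) × Dir d, k p.1.1 p.1.2 p.2 * w (p.1.1, p.2) * v p.1
    ∂((phaseMeasure D).prod (dirMeasure d))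

namespace IsSchurKernel

variable {k : Space d → Dir d → Dir d → ℝ}

/-- Exchanging the directions preserves the measure and turns this into the row version for the
transposed kernel. -/
theorem integrable_col (hk : IsSchurKernel D k) (w : TrialSpace D) :
    Integrable (fun p : (Space d × Dir d) × Dir d => k p.1.1 p.1.2 p.2 * w (p.1.1, p.2) ^ 2)
      ((phaseMeasure D).prod (dirMeasure d)) ∧
    ∫ p : (Space d × Dir d) × Dir d, k p.1.1 p.1.2 p.2 * w (p.1.1, p.2) ^ 2
      ∂((phaseMeasure D).prod (dirMeasure d))
      = ∫ z, rowSum (fun x s s' => k x s' s) z * w z ^ 2 ∂(phaseMeasure D) := by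
  obtain ⟨C, hC⟩ := hk.bdd_col
  obtain ⟨-, h2, h3⟩ := hk.col.integrable_mul_sq hC w
  have hτ := measurePreserving_swapDirs (d := d) (D := D)
  refine ⟨hτ.integrable_comp_of_integrable h2, ?_⟩
  rw [← h3]
  conv_rhs => rw [← hτ.map_eq]
  rw [integral_map hτ.measurable.aemeasurable]
  · rfl
  · rw [hτ.map_eq]
    exact h2.aestronglyMeasurable

theorem ae_nonneg (hk : IsSchurKernel D k) :
    ∀ᵐ p ∂((phaseMeasure D).prod (dirMeasure d)), 0 ≤ k p.1.1 p.1.2 p.2 := by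
  filter_upwards [Measure.quasiMeasurePreserving_fst.ae hk.row.nonneg] with p hp
  exact hp _

/-- The integrand is dominated by `k w² + k v²`, which the column and row bounds make integrable. -/
theorem integrable_form (hk : IsSchurKernel D k) (w v : TrialSpace D) :
    Integrable (fun p : (Space d × Dir d) × Dir d => k p.1.1 p.1.2 p.2 * w (p.1.1, p.2) * v p.1)
      ((phaseMeasure D).prod (dirMeasure d)) := by
  obtain ⟨C, hC⟩ := hk.bdd_row
  obtain ⟨-, h2, -⟩ := hk.row.integrable_mul_sq hC v
  have h1 := (hk.integrable_col w).1
  have hwm : Measurable w := (Lp.stronglyMeasurable w).measurable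
  have hvm : Measurable v := (Lp.stronglyMeasurable v).measurable
  refine Integrable.mono' (h1.add h2) ((hk.row.measurable.mul
    (hwm.comp (by fun_prop))).mul (hvm.comp measurable_fst)).aestronglyMeasurable ?_
  filter_upwards [hk.ae_nonneg] with p hp
  simp only [Pi.add_apply]
  rw [mul_assoc, norm_mul, Real.norm_of_nonneg hp, ← mul_add, Real.norm_eq_abs]
  have : |w (p.1.1, p.2) * v p.1| ≤ w (p.1.1, p.2) ^ 2 + v p.1 ^ 2 := by
    rw [abs_le]
    constructor <;> nlinarith [sq_nonneg (w (p.1.1, p.2) + v p.1),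
      sq_nonneg (w (p.1.1, p.2) - v p.1), sq_nonneg (w (p.1.1, p.2)), sq_nonneg (v p.1)]
  exact mul_le_mul_of_nonneg_left this hp

theorem kernelForm_add_left (hk : IsSchurKernel D k) (w₁ w₂ v : TrialSpace D) :
    kernelForm D k (w₁ + w₂) v = kernelForm D k w₁ v + kernelForm D k w₂ v := by
  unfold kernelForm
  rw [← integral_add (hk.integrable_form _ _) (hk.integrable_form _ _)]
  refine integral_congr_ae ?_
  have hτ := (measurePreserving_swapDirs (d := d) (D := D)).quasiMeasurePreserving.ae
    (Measure.quasiMeasurePreserving_fst.ae (Lp.coeFn_add w₁ w₂))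
  filter_upwards [hτ] with p hp
  simp only [swapDirs, Pi.add_apply] at hp
  rw [hp]
  ring

theorem kernelForm_smul_left (c : ℝ) (w v : TrialSpace D) :
    kernelForm D k (c • w) v = c * kernelForm D k w v := by
  unfold kernelForm
  rw [← integral_const_mul]
  refine integral_congr_ae ?_
  have hτ := (measurePreserving_swapDirs (d := d) (D := D)).quasiMeasurePreserving.ae
    (Measure.quasiMeasurePreserving_fst.ae (Lp.coeFn_smul c w))
  filter_upwards [hτ] with p hp
  simp only [swapDirs, Pi.smul_apply, smul_eq_mul] at hp
  rw [hp]
  ring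

theorem kernelForm_add_right (hk : IsSchurKernel D k) (w v₁ v₂ : TrialSpace D) :
    kernelForm D k w (v₁ + v₂) = kernelForm D k w v₁ + kernelForm D k w v₂ := by
  unfold kernelForm
  rw [← integral_add (hk.integrable_form _ _) (hk.integrable_form _ _)]
  refine integral_congr_ae ?_
  filter_upwards [Measure.quasiMeasurePreserving_fst.ae (Lp.coeFn_add v₁ v₂)] with p hp
  simp only [Pi.add_apply] at hp
  rw [hp]
  ring

theorem kernelForm_smul_right (c : ℝ) (w v : TrialSpace D) :
    kernelForm D k w (c • v) = c * kernelForm D k w v := by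
  unfold kernelForm
  rw [← integral_const_mul]
  refine integral_congr_ae ?_
  filter_upwards [Measure.quasiMeasurePreserving_fst.ae (Lp.coeFn_smul c v)] with p hp
  simp only [Pi.smul_apply, smul_eq_mul] at hp
  rw [hp]
  ring

/-- Young's inequality for the form of a kernel. -/
theorem two_mul_kernelForm_le (hk : IsSchurKernel D k) (a : ℝ) (w v : TrialSpace D) :
    2 * a * kernelForm D k w v ≤
      a ^ 2 * (∫ z, rowSum (fun x s s' => k x s' s) z * w z ^ 2 ∂(phaseMeasure D))
        + ∫ z, rowSum k z * v z ^ 2 ∂(phaseMeasure D) := by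
  obtain ⟨C, hC⟩ := hk.bdd_row
  obtain ⟨-, h2, h3⟩ := hk.row.integrable_mul_sq hC v
  obtain ⟨h4, h5⟩ := hk.integrable_col w
  unfold kernelForm
  rw [← h3, ← h5, ← integral_const_mul, ← integral_const_mul,
    ← integral_add (h4.const_mul _) h2]
  refine integral_mono_ae ((hk.integrable_form w v).const_mul _) ((h4.const_mul _).add h2) ?_
  filter_upwards [hk.ae_nonneg] with p hp
  have := mul_nonneg hp (sq_nonneg (a * w (p.1.1, p.2) - v p.1))
  nlinarith

theorem integral_rowSum_mul_sq_le {k : Space d → Dir d → Dir d → ℝ} (hk : IsScatterKernel D k)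
    {C : ℝ} (hC : ∀ᵐ z ∂(phaseMeasure D), rowSum k z ≤ C) (v : TrialSpace D) :
    ∫ z, rowSum k z * v z ^ 2 ∂(phaseMeasure D) ≤ C * ‖v‖ ^ 2 := by
  rw [norm_sq_eq_integral, ← integral_const_mul]
  refine integral_mono_ae (hk.integrable_mul_sq hC v).1 ((integrable_mul v v).const_mul C) ?_
  filter_upwards [hC] with z hz
  simp only [← sq]
  exact mul_le_mul_of_nonneg_right hz (sq_nonneg _)

/-- The Schur test. -/
theorem abs_kernelForm_le (hk : IsSchurKernel D k) {R C : ℝ} (hR0 : 0 ≤ R) (hC0 : 0 ≤ C)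
    (hR : ∀ᵐ z ∂(phaseMeasure D), rowSum k z ≤ R)
    (hC : ∀ᵐ z ∂(phaseMeasure D), rowSum (fun x s s' => k x s' s) z ≤ C) (w v : TrialSpace D) :
    |kernelForm D k w v| ≤ √(C * R) * ‖w‖ * ‖v‖ := by
  have h1 := integral_rowSum_mul_sq_le hk.row hR v
  have h2 := integral_rowSum_mul_sq_le hk.col hC w
  -- Young's inequality holds for every real `a`; the discriminant optimizes over `a` without
  -- dividing by norms that may vanish.
  have h3 : discrim (C * ‖w‖ ^ 2) (-(2 * kernelForm D k w v)) (R * ‖v‖ ^ 2) ≤ 0 := by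
    refine discrim_le_zero fun a => ?_
    have h4 := hk.two_mul_kernelForm_le a w v
    have h5 := mul_le_mul_of_nonneg_left h2 (sq_nonneg a)
    nlinarith
  rw [discrim] at h3
  refine abs_le_of_sq_le_sq ?_ (by positivity)
  rw [mul_pow, mul_pow, Real.sq_sqrt (by positivity)]
  nlinarith

/-- The operator of a kernel. -/
theorem exists_operator (hk : IsSchurKernel D k) :
    ∃ T : TrialSpace D →L[ℝ] TrialSpace D, ∀ w v, inner ℝ (T w) v = kernelForm D k w v := by
  obtain ⟨R, hR⟩ := hk.bdd_row
  obtain ⟨C, hC⟩ := hk.bdd_col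
  have hR' : ∀ᵐ z ∂(phaseMeasure D), rowSum k z ≤ |R| := hR.mono fun z hz => hz.trans (le_abs_self R)
  have hC' : ∀ᵐ z ∂(phaseMeasure D), rowSum (fun x s s' => k x s' s) z ≤ |C| :=
    hC.mono fun z hz => hz.trans (le_abs_self C)
  let B₀ : TrialSpace D →ₗ[ℝ] TrialSpace D →ₗ[ℝ] ℝ :=
    LinearMap.mk₂ ℝ (kernelForm D k) hk.kernelForm_add_left kernelForm_smul_left
      hk.kernelForm_add_right kernelForm_smul_right
  let B : TrialSpace D →L[ℝ] TrialSpace D →L[ℝ] ℝ := B₀.mkContinuous₂ √(|C| * |R|) fun w v =>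
    hk.abs_kernelForm_le (abs_nonneg R) (abs_nonneg C) hR' hC' w v
  refine ⟨InnerProductSpace.continuousLinearMapOfBilin (𝕜 := ℝ) B, fun w v => ?_⟩
  rw [InnerProductSpace.continuousLinearMapOfBilin_apply]
  rfl

theorem norm_operator_le (hk : IsSchurKernel D k) {T : TrialSpace D →L[ℝ] TrialSpace D}
    (hT : ∀ w v, inner ℝ (T w) v = kernelForm D k w v) {R C : ℝ} (hR0 : 0 ≤ R) (hC0 : 0 ≤ C)
    (hR : ∀ᵐ z ∂(phaseMeasure D), rowSum k z ≤ R)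
    (hC : ∀ᵐ z ∂(phaseMeasure D), rowSum (fun x s s' => k x s' s) z ≤ C) (w : TrialSpace D) :
    ‖T w‖ ≤ √(C * R) * ‖w‖ := by
  have h1 := (le_abs_self _).trans (hk.abs_kernelForm_le hR0 hC0 hR hC w (T w))
  rw [← hT, real_inner_self_eq_norm_sq] at h1
  rcases (norm_nonneg (T w)).eq_or_lt with h0 | h0
  · rw [← h0]; positivity
  · nlinarith

end IsSchurKernel

end Scattering

/-! ### Well-posedness of the radiative transfer equation -/

section AbstractSolution

variable {U V : Type*} [NormedAddCommGroup U] [InnerProductSpace ℝ U] [CompleteSpace U]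
  [NormedAddCommGroup V] [NormedSpace ℝ V] [CompleteSpace V]

theorem exists_inner_eq {B : V →L[ℝ] U} (hB : Function.Bijective B) (g : StrongDual ℝ V) :
    ∃ u : U, ∀ v, inner ℝ u (B v) = g v := by
  let e := ContinuousLinearEquiv.ofBijective B (LinearMap.ker_eq_bot.2 hB.1)
    (LinearMap.range_eq_top.2 hB.2)
  refine ⟨(InnerProductSpace.toDual ℝ U).symm (g.comp (e.symm : U →L[ℝ] V)), fun v => ?_⟩
  rw [InnerProductSpace.toDual_symm_apply]
  change g (e.symm (B v)) = g v
  congr 1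
  exact e.symm_apply_apply v

omit [CompleteSpace U] [CompleteSpace V] in
theorem eq_of_inner_eq {B : V →L[ℝ] U} (hB : Function.Surjective B) {u w : U}
    (h : ∀ v, inner ℝ u (B v) = inner ℝ w (B v)) : u = w := by
  refine ext_inner_right ℝ fun y => ?_
  obtain ⟨v, rfl⟩ := hB y
  exact h v

omit [CompleteSpace U] [CompleteSpace V] in
-- A duality argument: for `B v = u` one has `‖u‖² = ⟨q, j v⟩`, so a bound for `j B⁻¹` is also one
-- for its adjoint.
theorem norm_le_of_inner_eq {B j : V →L[ℝ] U} (hB : Function.Surjective B) {u q : U}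
    (h : ∀ v, inner ℝ u (B v) = inner ℝ q (j v)) {τ : ℝ} (hτ0 : 0 ≤ τ)
    (hτ : ∀ v, ‖j v‖ ≤ τ * ‖B v‖) :
    ‖u‖ ≤ τ * ‖q‖ := by
  obtain ⟨v, hv⟩ := hB u
  have h1 := h v
  have h2 := hτ v
  rw [hv] at h1 h2
  rw [real_inner_self_eq_norm_sq] at h1
  have h3 := (real_inner_le_norm q (j v)).trans (mul_le_mul_of_nonneg_left h2 (norm_nonneg q))
  rw [← h1] at h3
  rcases (norm_nonneg u).eq_or_lt with h0 | h0
  · rw [← h0]; positivity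
  · nlinarith

end AbstractSolution

section WellPosed

open Filter Topology

variable {d : ℕ} {D : Set (Space d)}

/-- The inclusion of `V` into `L₂`. -/
def fnL (D : Set (Space d)) : TestSpace D →L[ℝ] TrialSpace D :=
  (WithLp.fstL 2 ℝ (TrialSpace D) (TrialSpace D)).comp
    (smoothTestPairs D).topologicalClosure.subtypeL

/-- The derivative `s · ∇` as an operator on `V`. -/
def sdL (D : Set (Space d)) : TestSpace D →L[ℝ] TrialSpace D :=
  (WithLp.sndL 2 ℝ (TrialSpace D) (TrialSpace D)).comp
    (smoothTestPairs D).topologicalClosure.subtypeL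

theorem norm_testSpace_le (v : TestSpace D) : ‖v‖ ≤ ‖fnL D v‖ + ‖sdL D v‖ := by
  have h := WithLp.prod_norm_eq_of_L2 (v : WithLp 2 (TrialSpace D × TrialSpace D))
  change ‖(v : WithLp 2 (TrialSpace D × TrialSpace D))‖ ≤ _
  rw [h]
  refine (Real.sqrt_le_left (by positivity)).2 ?_
  have h1 : (WithLp.fst (v : WithLp 2 (TrialSpace D × TrialSpace D))) = fnL D v := rfl
  have h2 : (WithLp.snd (v : WithLp 2 (TrialSpace D × TrialSpace D))) = sdL D v := rfl
  rw [h1, h2]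
  nlinarith [norm_nonneg (fnL D v), norm_nonneg (sdL D v)]

theorem bijective_of_coercive (ho : IsOpen D) (hb : Bornology.IsBounded D) (hc : Convex ℝ D)
    {M : TrialSpace D →L[ℝ] TrialSpace D} {α : ℝ} (hα : 0 < α)
    (hM : ∀ u, α * ‖u‖ ^ 2 ≤ inner ℝ (M u) u) : Function.Bijective (M ∘L fnL D - sdL D) :=
  bijective_of_accretive norm_testSpace_le (inner_sd_fn_nonpos ho hb hc)
    (fun l _ _ hw => eq_zero_of_orthogonal ho hb l hw) hα hM

/-! ### Coercivity, contraction and solution operators for admissible optical parameters -/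

namespace Optics

variable {c : Optics d}

/-- The kernel of `𝒦`, with the direction of the result first. -/
def kernel (c : Optics d) (x : Space d) (s s' : Dir d) : ℝ := c.K x s' s

/-- Square integrability in the directions makes almost all rows and columns integrable, the sphere
having finite measure. The integrals `σ̄'` (rows) and `σ̄` (columns) are then genuine and not the
default value `0`. -/
theorem Admissible.isSchurKernel (hc : c.Admissible D) (ho : IsOpen D) :
    IsSchurKernel D c.kernel := by
  obtain ⟨C, hC⟩ := hc.bounded_K
  have hm : ∀ x, Measurable fun p : Dir d × Dir d => c.K x p.1 p.2 := fun x =>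
    hc.measurable_K.comp measurable_prodMk_left
  have hint : ∀ᵐ x ∂(volume.restrict D), Integrable (fun p : Dir d × Dir d => c.K x p.1 p.2)
      ((dirMeasure d).prod (dirMeasure d)) := by
    filter_upwards [hC] with x hx
    refine MemLp.integrable (q := 2) (by norm_num) ?_
    rw [memLp_two_iff_integrable_sq (hm x).aestronglyMeasurable]
    refine ⟨((hm x).pow_const 2).aestronglyMeasurable, ?_⟩
    rw [hasFiniteIntegral_iff_ofReal (Eventually.of_forall fun p => sq_nonneg _)]
    exact hx.trans_lt ENNReal.ofReal_lt_top
  refine ⟨isScatterKernel_of_sq ho ?_ (fun x hx s s' => hc.nonneg_K x hx s' s) ?_,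
    isScatterKernel_of_sq ho hc.measurable_K hc.nonneg_K hint, ⟨c.M', hc.in_le⟩, ⟨c.M, hc.out_le⟩⟩
  · exact hc.measurable_K.comp
      (by fun_prop : Measurable fun p : Space d × Dir d × Dir d => (p.1, p.2.2, p.2.1))
  · filter_upwards [hint] with x hx
    exact hx.swap

theorem Admissible.outScat_nonneg (hc : c.Admissible D) (ho : IsOpen D) :
    ∀ᵐ z ∂(phaseMeasure D), 0 ≤ c.outScat z := (hc.isSchurKernel ho).col.rowSum_nonneg

theorem Admissible.inScat_nonneg (hc : c.Admissible D) (ho : IsOpen D) :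
    ∀ᵐ z ∂(phaseMeasure D), 0 ≤ c.inScat z := (hc.isSchurKernel ho).row.rowSum_nonneg

theorem Admissible.α_le_σ (hc : c.Admissible D) (ho : IsOpen D) :
    ∀ᵐ z ∂(phaseMeasure D), c.α ≤ c.σ z := by
  filter_upwards [hc.outScat_nonneg ho, hc.gap_out] with z h1 h2
  linarith

theorem Admissible.exists_abs_σ_le (hc : c.Admissible D) :
    ∃ C, ∀ᵐ z ∂(phaseMeasure D), |c.σ z| ≤ C := by
  obtain ⟨C, hC⟩ := hc.bounded_σ
  refine ⟨C, ?_⟩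
  filter_upwards [hC, hc.nonneg_σ] with z h1 h2
  rwa [abs_of_nonneg h2]

theorem Admissible.shift (hc : c.Admissible D) {a : ℝ} (ha : 0 < a) :
    (c.shift a).Admissible D where
  measurable_σ := hc.measurable_σ.add_const a
  nonneg_σ := hc.nonneg_σ.mono fun z hz => add_nonneg hz ha.le
  bounded_σ := by
    obtain ⟨C, hC⟩ := hc.bounded_σ
    exact ⟨C + a, hC.mono fun z hz => add_le_add_left hz a⟩
  measurable_K := hc.measurable_K
  nonneg_K := hc.nonneg_K
  bounded_K := hc.bounded_K
  pos_α := add_pos hc.pos_α ha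
  gap_out := hc.gap_out.mono fun z hz => by
    change c.α + a ≤ c.σ z + a - c.outScat z
    linarith
  gap_in := hc.gap_in.mono fun z hz => by
    change c.α + a ≤ c.σ z + a - c.inScat z
    linarith
  out_le := hc.out_le
  in_le := hc.in_le

theorem transportForm_eq {T : TrialSpace D →L[ℝ] TrialSpace D}
    (hT : ∀ w : TrialSpace D, T w =ᵐ[phaseMeasure D] fun z => c.σ z * w z)
    (w : TrialSpace D) (v : TestSpace D) :
    c.transportForm w v = inner ℝ w (T v.fn - v.sd) := by
  rw [inner_eq_integral, transportForm]
  refine integral_congr_ae ?_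
  filter_upwards [hT v.fn, Lp.coeFn_sub (T v.fn) v.sd] with z h1 h2
  rw [h2, Pi.sub_apply, h1]

theorem Admissible.scatterForm_eq (hc : c.Admissible D) (ho : IsOpen D)
    {K : TrialSpace D →L[ℝ] TrialSpace D} (hK : ∀ w v, inner ℝ (K w) v = kernelForm D c.kernel w v)
    (w : TrialSpace D) (v : TestSpace D) : c.scatterForm w v = inner ℝ (K w) v.fn := by
  rw [hK, kernelForm, integral_prod _ ((hc.isSchurKernel ho).integrable_form w v.fn), scatterForm]
  simp only [integral_mul_const]
  rfl

/-- Young's inequality gives `2 ⟨𝒦 u, u⟩ ≤ ∫ (σ̄ + σ̄') u²`, and the sum of the two gap conditions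
is `2 σ ≥ 2 α + σ̄ + σ̄'`. -/
theorem Admissible.coercive (hc : c.Admissible D) (ho : IsOpen D)
    {T K : TrialSpace D →L[ℝ] TrialSpace D}
    (hT : ∀ w : TrialSpace D, T w =ᵐ[phaseMeasure D] fun z => c.σ z * w z)
    (hK : ∀ w v, inner ℝ (K w) v = kernelForm D c.kernel w v) (u : TrialSpace D) :
    c.α * ‖u‖ ^ 2 ≤ inner ℝ ((T - ContinuousLinearMap.adjoint K) u) u := by
  have hk := hc.isSchurKernel ho
  have h1 := hk.two_mul_kernelForm_le 1 u u
  have hr := (hk.row.integrable_mul_sq hc.in_le u).1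
  have hl := (hk.col.integrable_mul_sq hc.out_le u).1
  have h0 : Integrable (fun z => 2 * (c.α * (u z * u z))) (phaseMeasure D) :=
    ((integrable_mul u u).const_mul _).const_mul _
  have hs : Integrable (fun z => 2 * (c.α * (u z * u z))
      + rowSum (fun x s s' => c.kernel x s' s) z * u z ^ 2) (phaseMeasure D) := h0.add hl
  have h2 : 2 * (c.α * ‖u‖ ^ 2) + (∫ z, rowSum (fun x s s' => c.kernel x s' s) z * u z ^ 2
      ∂(phaseMeasure D)) + ∫ z, rowSum c.kernel z * u z ^ 2 ∂(phaseMeasure D)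
      ≤ 2 * inner ℝ (T u) u := by
    rw [norm_sq_eq_integral, inner_eq_integral, ← integral_const_mul, ← integral_const_mul,
      ← integral_const_mul, ← integral_add h0 hl, ← integral_add hs hr]
    refine integral_mono_ae (hs.add hr) ((integrable_mul (T u) u).const_mul 2) ?_
    filter_upwards [hT u, hc.gap_in, hc.gap_out] with z h3 h4 h5
    rw [h3]
    have h6 := mul_le_mul_of_nonneg_right h4 (sq_nonneg (u z))
    have h7 := mul_le_mul_of_nonneg_right h5 (sq_nonneg (u z))
    have h8 : rowSum c.kernel z = c.inScat z := rfl
    have h9 : rowSum (fun x s s' => c.kernel x s' s) z = c.outScat z := rfl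
    simp only [h8, h9]
    nlinarith
  rw [sub_apply, inner_sub_left, ContinuousLinearMap.adjoint_inner_left,
    real_inner_comm (K u) u, hK]
  linarith

theorem Admissible.isBoundedUnder_le (hc : c.Admissible D) :
    (ae (phaseMeasure D)).IsBoundedUnder (· ≤ ·) c.σ := hc.bounded_σ

theorem Admissible.isBoundedUnder_ge (hc : c.Admissible D) :
    (ae (phaseMeasure D)).IsBoundedUnder (· ≥ ·) c.σ := ⟨0, hc.nonneg_σ⟩

theorem Admissible.σmin_le (hc : c.Admissible D) : ∀ᵐ z ∂(phaseMeasure D), c.σmin D ≤ c.σ z :=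
  ae_essInf_le hc.isBoundedUnder_ge

theorem Admissible.le_σmax (hc : c.Admissible D) : ∀ᵐ z ∂(phaseMeasure D), c.σ z ≤ c.σmax D :=
  ae_le_essSup hc.isBoundedUnder_le

/-- A real-valued `essInf` inherits lower bounds only if the measure is nonzero, hence the `NeBot`
assumption. -/
theorem Admissible.σmin_pos [NeBot (ae (phaseMeasure D))] (hc : c.Admissible D)
    (ho : IsOpen D) : 0 < c.σmin D :=
  hc.pos_α.trans_le (le_liminf_of_le hc.isBoundedUnder_le.isCoboundedUnder_ge (hc.α_le_σ ho))

theorem Admissible.outScat_and_inScat_le (hc : c.Admissible D) (ho : IsOpen D) :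
    (∀ᵐ z ∂(phaseMeasure D), c.outScat z ≤ c.γ D * c.σ z) ∧
      ∀ᵐ z ∂(phaseMeasure D), c.inScat z ≤ c.γ D * c.σ z := by
  -- A real-valued `essSup` dominates the function only when the latter is essentially bounded. Here
  -- both ratios are at most `1`.
  have hbdd : (ae (phaseMeasure D)).IsBoundedUnder (· ≤ ·)
      fun z => max (c.outScat z / c.σ z) (c.inScat z / c.σ z) := by
    refine ⟨1, ?_⟩
    rw [eventually_map]
    filter_upwards [hc.α_le_σ ho, hc.gap_out, hc.gap_in] with z h1 h2 h3
    have hσ : 0 < c.σ z := hc.pos_α.trans_le h1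
    have := hc.pos_α
    rw [max_le_iff, div_le_one hσ, div_le_one hσ]
    constructor <;> linarith
  have hγ : ∀ᵐ z ∂(phaseMeasure D), max (c.outScat z / c.σ z) (c.inScat z / c.σ z) ≤ c.γ D :=
    ae_le_essSup hbdd
  constructor
  · filter_upwards [hγ, hc.α_le_σ ho] with z h1 h2
    rw [← div_le_iff₀ (hc.pos_α.trans_le h2)]
    exact (le_max_left _ _).trans h1
  · filter_upwards [hγ, hc.α_le_σ ho] with z h1 h2
    rw [← div_le_iff₀ (hc.pos_α.trans_le h2)]
    exact (le_max_right _ _).trans h1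

theorem Admissible.norm_scatter_le [NeBot (ae (phaseMeasure D))] (hc : c.Admissible D)
    (ho : IsOpen D) {K : TrialSpace D →L[ℝ] TrialSpace D}
    (hK : ∀ w v, inner ℝ (K w) v = kernelForm D c.kernel w v) {A B : ℝ}
    (hA : ∀ᵐ z ∂(phaseMeasure D), c.outScat z ≤ A) (hB : ∀ᵐ z ∂(phaseMeasure D), c.inScat z ≤ B) :
    0 ≤ A ∧ 0 ≤ B ∧ ∀ w, ‖K w‖ ≤ √(A * B) * ‖w‖ := by
  obtain ⟨z, h1, h2⟩ := (hA.and (hc.outScat_nonneg ho)).exists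
  obtain ⟨y, h3, h4⟩ := (hB.and (hc.inScat_nonneg ho)).exists
  have hA0 := h2.trans h1
  have hB0 := h4.trans h3
  exact ⟨hA0, hB0, (hc.isSchurKernel ho).norm_operator_le hK hB0 hA0 hB hA⟩

theorem inner_mulOperator_ge {T : TrialSpace D →L[ℝ] TrialSpace D}
    (hT : ∀ w : TrialSpace D, T w =ᵐ[phaseMeasure D] fun z => c.σ z * w z) {m : ℝ}
    (hm : ∀ᵐ z ∂(phaseMeasure D), m ≤ c.σ z) (u : TrialSpace D) :
    m * ‖u‖ ^ 2 ≤ inner ℝ (T u) u := by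
  rw [norm_sq_eq_integral, inner_eq_integral, ← integral_const_mul]
  refine integral_mono_ae ((integrable_mul u u).const_mul m) (integrable_mul (T u) u) ?_
  filter_upwards [hT u, hm] with z h1 h2
  rw [h1, mul_assoc]
  exact mul_le_mul_of_nonneg_right h2 (mul_self_nonneg _)

/-- The solution operator of transport after scattering is bounded by the contraction number. -/
theorem Admissible.norm_le_contractionBound [NeBot (ae (phaseMeasure D))] (hc : c.Admissible D)
    (ho : IsOpen D) (hb : Bornology.IsBounded D) (hconv : Convex ℝ D) (hdiam : 0 < Metric.diam D)
    {T K : TrialSpace D →L[ℝ] TrialSpace D}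
    (hT : ∀ w : TrialSpace D, T w =ᵐ[phaseMeasure D] fun z => c.σ z * w z)
    (hK : ∀ w v, inner ℝ (K w) v = kernelForm D c.kernel w v)
    (hB : Function.Surjective (T ∘L fnL D - sdL D)) {u w : TrialSpace D}
    (h : ∀ v, inner ℝ u ((T ∘L fnL D - sdL D) v) = inner ℝ (K w) (fnL D v)) :
    ‖u‖ ≤ c.contractionBound D * ‖w‖ := by
  have hσ := hc.σmin_pos ho
  -- Every entry of the minimum is a scattering norm `κ` from the Schur test times a transport bound
  -- `τ`, which is `1 / σ_min`, `diam D` or `√(diam D / (2 σ_min))`.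
  have key : ∀ τ κ : ℝ, 0 ≤ τ → (∀ v, ‖fnL D v‖ ≤ τ * ‖(T ∘L fnL D - sdL D) v‖) →
      (∀ w, ‖K w‖ ≤ κ * ‖w‖) → ‖u‖ ≤ κ * τ * ‖w‖ := by
    intro τ κ hτ0 hτ hκ
    refine (norm_le_of_inner_eq hB h hτ0 hτ).trans ?_
    rw [mul_comm κ, mul_assoc]
    exact mul_le_mul_of_nonneg_left (hκ w) hτ0
  have hinv : ∀ v, ‖fnL D v‖ ≤ (c.σmin D)⁻¹ * ‖(T ∘L fnL D - sdL D) v‖ := fun v =>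
    norm_le_of_accretive (j := fnL D) (s := sdL D) (inner_sd_fn_nonpos ho hb hconv) hσ
      (inner_mulOperator_ge hT hc.σmin_le) v
  have hfirst : ∀ A : ℝ, (∀ᵐ z ∂(phaseMeasure D), c.outScat z ≤ A) →
      (∀ᵐ z ∂(phaseMeasure D), c.inScat z ≤ A) → ‖u‖ ≤ A / c.σmin D * ‖w‖ := by
    intro A h1 h2
    obtain ⟨hA, -, h3⟩ := hc.norm_scatter_le ho hK h1 h2
    rw [Real.sqrt_mul_self hA] at h3
    rw [div_eq_mul_inv]
    exact key _ _ (inv_nonneg.2 hσ.le) hinv h3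
  obtain ⟨z₀, hz₀, hz₁, hz₂⟩ := ((hc.outScat_and_inScat_le ho).1.and
    ((hc.outScat_nonneg ho).and (hc.α_le_σ ho))).exists
  have hγ : 0 ≤ c.γ D := by
    have := hc.pos_α.trans_le hz₂
    by_contra! hneg
    nlinarith
  have h1 : ‖u‖ ≤ c.γ D * c.σmax D / c.σmin D * ‖w‖ := by
    refine hfirst _ ?_ ?_
    · filter_upwards [(hc.outScat_and_inScat_le ho).1, hc.le_σmax] with z h1 h2
      exact h1.trans (mul_le_mul_of_nonneg_left h2 hγ)
    · filter_upwards [(hc.outScat_and_inScat_le ho).2, hc.le_σmax] with z h1 h2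
      exact h1.trans (mul_le_mul_of_nonneg_left h2 hγ)
  have h2 : ‖u‖ ≤ (c.σmax D - c.α) / c.σmin D * ‖w‖ := by
    refine hfirst _ ?_ ?_
    · filter_upwards [hc.gap_out, hc.le_σmax] with z h1 h2
      linarith
    · filter_upwards [hc.gap_in, hc.le_σmax] with z h1 h2
      linarith
  obtain ⟨-, -, hMM⟩ := hc.norm_scatter_le ho hK hc.out_le hc.in_le
  have h3 : ‖u‖ ≤ √(c.M * c.M') * Metric.diam D * ‖w‖ :=
    key _ _ hdiam.le (norm_fn_le_diam_mul ho hb hconv hdiam hT hc.nonneg_σ) hMM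
  have h4 : ‖u‖ ≤ √(c.M * c.M') * √(Metric.diam D / (2 * c.σmin D)) * ‖w‖ := by
    refine key _ _ (Real.sqrt_nonneg _) (fun v => ?_) hMM
    have := norm_fn_sq_le_of_pos ho hb hconv hT hσ hc.σmin_le v
    refine le_of_sq_le_sq ?_ (by positivity)
    rw [mul_pow, Real.sq_sqrt (by positivity)]
    exact this
  unfold contractionBound
  rcases min_choice (c.γ D * c.σmax D / c.σmin D) (min ((c.σmax D - c.α) / c.σmin D)
      (√(c.M * c.M') * min (Metric.diam D) (√(Metric.diam D / (2 * c.σmin D))))) with h | h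
  · rw [h]; exact h1
  rw [h]
  rcases min_choice ((c.σmax D - c.α) / c.σmin D)
      (√(c.M * c.M') * min (Metric.diam D) (√(Metric.diam D / (2 * c.σmin D)))) with h | h
  · rw [h]; exact h2
  rw [h]
  rcases min_choice (Metric.diam D) (√(Metric.diam D / (2 * c.σmin D))) with h | h
  · rw [h]; exact h3
  · rw [h]; exact h4

/-- The analysis of the transport equation on `D`. -/
theorem Admissible.exists_isTransportInverse [NeBot (ae (phaseMeasure D))] (hc : c.Admissible D)
    (ho : IsOpen D) (hb : Bornology.IsBounded D) (hconv : Convex ℝ D)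
    (hdiam : 0 < Metric.diam D) :
    ∃ (S : DualSpace D → TrialSpace D) (k : TrialSpace D → DualSpace D),
      IsTransportInverse c S k := by
  obtain ⟨C, hC⟩ := hc.exists_abs_σ_le
  obtain ⟨T, hT⟩ := exists_mulOperator hc.measurable_σ hC
  obtain ⟨K, hK⟩ := (hc.isSchurKernel ho).exists_operator
  have hB := bijective_of_coercive ho hb hconv (hc.σmin_pos ho)
    (inner_mulOperator_ge hT hc.σmin_le)
  have hform : ∀ w v, c.transportForm w v = inner ℝ w ((T ∘L fnL D - sdL D) v) :=
    transportForm_eq hT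
  have hscat : ∀ w v, c.scatterForm w v = inner ℝ (K w) (fnL D v) := hc.scatterForm_eq ho hK
  choose S hS using fun g : DualSpace D => exists_inner_eq hB g
  have huniq : ∀ g u, (∀ v, inner ℝ u ((T ∘L fnL D - sdL D) v) = g v) → u = S g := fun g u hu =>
    eq_of_inner_eq hB.2 fun v => (hu v).trans (hS g v).symm
  refine ⟨S, fun w => embed (K w), ?_, ?_, ?_, ?_, hscat, ?_, ?_⟩
  · intro g h
    refine (huniq _ _ fun v => ?_).symm
    rw [inner_add_left, hS, hS]
    rfl
  · intro v w
    ext y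
    change inner ℝ (K (v + w)) y.fn = inner ℝ (K v) y.fn + inner ℝ (K w) y.fn
    rw [map_add, inner_add_left]
  · intro u
    exact ⟨(innerSL ℝ u).comp (T ∘L fnL D - sdL D), (huniq _ _ fun v => rfl).symm⟩
  · intro g v
    rw [hform, hS]
  · intro f u hu
    refine huniq _ _ fun v => ?_
    have := hu v
    rw [hform, hscat, sub_eq_iff_eq_add'] at this
    exact this
  · intro w
    exact hc.norm_le_contractionBound ho hb hconv hdiam hT hK hB.2 fun v => hS _ v

/-- The form of the radiative transfer equation comes from a bijective operator. -/
theorem Admissible.exists_operator (hc : c.Admissible D)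
    (ho : IsOpen D) (hb : Bornology.IsBounded D) (hconv : Convex ℝ D) :
    ∃ B : TestSpace D →L[ℝ] TrialSpace D, Function.Bijective B ∧
      (∀ v, ‖fnL D v‖ ≤ c.α⁻¹ * ‖B v‖) ∧
      ∀ w v, c.transportForm w v - c.scatterForm w v = inner ℝ w (B v) := by
  obtain ⟨C, hC⟩ := hc.exists_abs_σ_le
  obtain ⟨T, hT⟩ := exists_mulOperator hc.measurable_σ hC
  obtain ⟨K, hK⟩ := (hc.isSchurKernel ho).exists_operator
  have hM := hc.coercive ho hT hK
  -- The coefficient is `σ - 𝒦*`: scattering acts on the trial function and is moved to the test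
  -- function.
  refine ⟨_, bijective_of_coercive ho hb hconv hc.pos_α hM, fun v => ?_, fun w v => ?_⟩
  · exact norm_le_of_accretive (j := fnL D) (s := sdL D) (inner_sd_fn_nonpos ho hb hconv)
      hc.pos_α hM v
  · rw [transportForm_eq hT, hc.scatterForm_eq ho hK, ← ContinuousLinearMap.adjoint_inner_right,
      ← inner_sub_right]
    congr 1
    change T v.fn - v.sd - _ = T v.fn - _ - v.sd
    abel

/-- Existence, uniqueness, and stability of solutions. -/
theorem Admissible.exists_solution (hc : c.Admissible D)
    (ho : IsOpen D) (hb : Bornology.IsBounded D) (hconv : Convex ℝ D) :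
    ∃ R : DualSpace D → TrialSpace D, (∀ g, c.IsSolution g (R g)) ∧
      (∀ g u, c.IsSolution g u → u = R g) ∧
      (∀ w : TrialSpace D, ‖R (embed w)‖ ≤ c.α⁻¹ * ‖w‖) := by
  obtain ⟨B, hB, hbound, hform⟩ := hc.exists_operator ho hb hconv
  choose R hR using fun g : DualSpace D => exists_inner_eq hB g
  refine ⟨R, fun g v => by rw [hform, hR], fun g u hu => ?_, fun w => ?_⟩
  · refine eq_of_inner_eq hB.2 fun v => ?_
    rw [hR, ← hform, hu v]
  · exact norm_le_of_inner_eq hB.2 (fun v => hR _ v) (inv_nonneg.2 hc.pos_α.le) hbound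

/-- The default value `α⁻¹ ‖f‖` is legitimate by the stability estimate for sources in `L₂`. -/
theorem IsInitialBound.norm_le {f : DualSpace D} {b : ℝ} (h : c.IsInitialBound f b)
    {R : DualSpace D → TrialSpace D} (hR : ∀ g, c.IsSolution g (R g))
    (hbound : ∀ w : TrialSpace D, ‖R (embed w)‖ ≤ c.α⁻¹ * ‖w‖) : ‖R f‖ ≤ b := by
  rcases h with h | ⟨F, rfl, rfl⟩
  · exact h _ (hR f)
  · exact hbound F

theorem Admissible.transportForm_shift (hc : c.Admissible D) {a : ℝ} (w : TrialSpace D)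
    (v : TestSpace D) :
    (c.shift a).transportForm w v = c.transportForm w v + a * inner ℝ w v.fn := by
  obtain ⟨C, hC⟩ := hc.exists_abs_σ_le
  obtain ⟨T, hT⟩ := exists_mulOperator hc.measurable_σ hC
  have hT' : ∀ w : TrialSpace D, (T + a • ContinuousLinearMap.id ℝ (TrialSpace D)) w
      =ᵐ[phaseMeasure D] fun z => (c.shift a).σ z * w z := by
    intro w
    filter_upwards [hT w, Lp.coeFn_add (T w) (a • w), Lp.coeFn_smul a w] with z h1 h2 h3
    change (T w + a • w : TrialSpace D) z = (c.σ z + a) * w z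
    rw [h2, Pi.add_apply, h1, h3, Pi.smul_apply, smul_eq_mul]
    ring
  rw [transportForm_eq hT', transportForm_eq hT, ← real_inner_smul_right, ← inner_add_right]
  congr 1
  change T v.fn + a • v.fn - v.sd = _
  abel

/-- The fixed-point equation of the nested iteration. -/
theorem Admissible.nested_fixedPoint (hc : c.Admissible D) {a : ℝ} (ha : 0 < a)
    {R : DualSpace D → TrialSpace D} (hR : ∀ g, (c.shift a).IsSolution g (R g))
    {B : TestSpace D →L[ℝ] TrialSpace D} (hB : Function.Surjective B)
    (hform : ∀ w v, (c.shift a).transportForm w v - (c.shift a).scatterForm w v = inner ℝ w (B v))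
    {f : DualSpace D} {u : TrialSpace D} (hu : c.IsSolution f u) {w e : TrialSpace D}
    {g : DualSpace D} (hg : a⁻¹ • f - g = embed e) :
    u - a • R (embed w + g) = a • R (embed (u - w)) + a • R (embed e) := by
  refine eq_of_inner_eq hB fun v => ?_
  have hRB : ∀ g, inner ℝ (R g) (B v) = g v := fun g => by rw [← hform]; exact hR g v
  -- The original solution solves the shifted equation with source `f + a u`, so `u = a R (u + a⁻¹
  -- f)`; comparison with the source `w + g` leaves `u - w` and `e`.
  have huB : inner ℝ u (B v) = f v + a * inner ℝ u v.fn := by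
    rw [← hform, hc.transportForm_shift, ← hu v]
    change _ - c.scatterForm u v = _
    ring
  have hgv : a⁻¹ * f v - g v = inner ℝ e v.fn := congrArg (fun A : DualSpace D => A v) hg
  rw [inner_sub_left, inner_add_left, real_inner_smul_left, real_inner_smul_left,
    real_inner_smul_left, hRB, hRB, hRB, huB]
  change _ - a * (inner ℝ w v.fn + g v) = a * inner ℝ (u - w) v.fn + a * inner ℝ e v.fn
  rw [← hgv, inner_sub_left]
  field_simp
  ring

end Optics

/-- For `d = 0` the unit sphere is empty and the phase measure vanishes; from `d = 1` on, both
factors are nonzero. -/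
theorem ae_phaseMeasure_neBot (hd : 1 ≤ d) (ho : IsOpen D) (hne : D.Nonempty) :
    NeBot (ae (phaseMeasure D)) := by
  have : Nonempty (Fin d) := ⟨⟨0, hd⟩⟩
  have h1 : (volume.restrict D : Measure (Space d)) ≠ 0 := by
    rw [Ne, Measure.restrict_eq_zero]
    exact (ho.measure_pos volume hne).ne'
  have h2 : dirMeasure d ≠ 0 := Measure.toSphere_ne_zero _
  rw [ae_neBot, phaseMeasure, Ne, ← Measure.measure_univ_eq_zero, ← Set.univ_prod_univ,
    Measure.prod_prod, mul_eq_zero, Measure.measure_univ_eq_zero, Measure.measure_univ_eq_zero]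
  tauto

theorem diam_pos_of_isOpen (hd : 1 ≤ d) (ho : IsOpen D) (hne : D.Nonempty)
    (hb : Bornology.IsBounded D) : 0 < Metric.diam D := by
  have : Nonempty (Fin d) := ⟨⟨0, hd⟩⟩
  obtain ⟨x, hx⟩ := hne
  have : NeBot (𝓝[≠] x) := Module.punctured_nhds_neBot ℝ (Space d) x
  exact Metric.diam_pos (infinite_of_mem_nhds x (ho.mem_nhds hx)).nontrivial hb

end WellPosed

end RadTrans

end

/-! ### Convergence of N-ASTI in both regimes -/

theorem mainTheorem1 (d : ℕ) (hd : 1 ≤ d) (D : Set (RadTrans.Space d))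
    (hD_open : IsOpen D) (hD_nonempty : D.Nonempty) (hD_bounded : Bornology.IsBounded D)
    (hD_convex : Convex ℝ D)
    (c : RadTrans.Optics d) (hc : c.Admissible D)
    (f : RadTrans.DualSpace D)
    (P : RadTrans.NAstiData D) (hP : P.Admissible c f)
    (ε : ℝ) (hε : 0 < ε) :
    ∃ u : RadTrans.TrialSpace D,
      c.IsSolution f u ∧ (∀ w : RadTrans.TrialSpace D, c.IsSolution f w → w = u) ∧
      (RadTrans.nAsti P f ε).Dom ∧
      ∀ uε ∈ RadTrans.nAsti P f ε, ‖u - uε‖ ≤ ε := by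
  have hbot := RadTrans.ae_phaseMeasure_neBot hd hD_open hD_nonempty
  have hdiam := RadTrans.diam_pos_of_isOpen hd hD_open hD_nonempty hD_bounded
  obtain ⟨R, hR, huniq, hbound⟩ := hc.exists_solution hD_open hD_bounded hD_convex
  refine ⟨R f, hR f, huniq f, ?_⟩
  -- A partial value has at most one element, so one accurate output gives both termination and the
  -- bound for every output.
  suffices h : ∃ r ∈ RadTrans.nAsti P f ε, ‖R f - r‖ ≤ ε by
    obtain ⟨r, hr, hrε⟩ := h
    exact ⟨Part.dom_iff_mem.2 ⟨r, hr⟩, fun y hy => Part.mem_unique hr hy ▸ hrε⟩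
  unfold RadTrans.nAsti
  split_ifs with hρ
  · have hA := hP.transport_admissible hρ
    obtain ⟨S, k, hS⟩ := hc.exists_isTransportInverse hD_open hD_bounded hD_convex hdiam
    exact RadTrans.exists_mem_asti hA hS (hR f) ((hA.initial f).norm_le hR hbound) hε
  · have hN := hP.nested_admissible (not_lt.1 hρ)
    have hc' := hc.shift hN.pos_a
    obtain ⟨S, k, hS⟩ := hc'.exists_isTransportInverse hD_open hD_bounded hD_convex hdiam
    obtain ⟨R', hR', -, hbound'⟩ := hc'.exists_solution hD_open hD_bounded hD_convex
    obtain ⟨B, hB, -, hform⟩ := hc'.exists_operator hD_open hD_bounded hD_convex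
    exact RadTrans.exists_mem_nested hN hc.pos_α hS hR'
      (fun g => (hN.inner_admissible.initial g).norm_le hR' hbound') hbound'
      (fun w e g hg => hc.nested_fixedPoint hN.pos_a hR' hB.2 hform (hR f) hg)
      (hN.initial.norm_le hR hbound) hε
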